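/- Let $A$ be a $C^*$-algebra, let $\alpha=(\alpha_t)_{t\in\mathbb R}$ be a point-wise norm-continuous one-parameter group of $*$-automorphisms of $A$, and let $p\in A$ be a projection with $\alpha_t(p)=p$ for all $t\in\mathbb R$ which is full, i.e. the closed two-sided ideal of $A$ generated by $p$ is $A$. Let $\beta\in\mathbb R$. A weight $\psi:A_+\to[0,\infty]$ is additive and positively homogeneous; it is proper when it is non-zero, densely defined and lower semi-continuous. Put $\mathcal N_\psi=\{a\in A:\psi(a^*a)<\infty\}$ and denote also by $\psi$ its unique linear extension to $\mathcal N_\psi^*\mathcal N_\psi=\operatorname{Span}\{a^*b: a,b\in\mathcal N_\psi\}$. A proper weight $\psi$ is a $\beta$-KMS weight for $\alpha$ when $\psi\circ\alpha_t=\psi$ for all $t$ and, for all $a,b\in\mathcal N_\psi\cap\mathcal N_\psi^*$, there is a continuous bounded function $F$ on the closed strip of those $z\in\mathbb C$ whose imaginary part lies between $0$ and $\beta$, holomorphic in its interior, with $F(t)=\psi(a\alpha_t(b))$ and $F(t+i\beta)=\psi(\alpha_t(b)a)$ for all $t\in\mathbb R$. Let $\psi$ be a $\beta$-KMS weight for $\alpha$,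 and let $(H_\psi,\Lambda_\psi,\pi_\psi)$ be a GNS construction of $\psi$: a Hilbert space $H_\psi$, a linear map $\Lambda_\psi:\mathcal N_\psi\to H_\psi$ with dense range and a non-degenerate representation $\pi_\psi$ of $A$ on $H_\psi$ with $\psi(b^*a)=\langle\Lambda_\psi(a),\Lambda_\psi(b)\rangle$ for $a,b\in\mathcal N_\psi$ and $\pi_\psi(a)\Lambda_\psi(b)=\Lambda_\psi(ab)$ for $a\in A$, $b\in\mathcal N_\psi$. Let $\varphi(x)=\psi(p)^{-1}\psi(x)$, $x\in pAp$, and let $(\pi_\varphi,H_\varphi,\xi_\varphi)$ be a GNS triple of the state $\varphi$ on $pAp$. Let $\theta$ be the modular group on $\pi_\psi(A)''$ given by $\theta_t=\operatorname{Ad}U_{-\beta t}$, where $U_s$ is the unitary on $H_\psi$ with $U_s\Lambda_\psi(a)=\Lambda_\psi(\alpha_s(a))$ for $a\in\mathcal N_\psi$; and let $\theta'$ be the modular group on $\pi_\varphi(pAp)''$ given by $\theta'_t=\operatorname{Ad}U'_{-\beta t}$, where $U'_s$ is the unitary on $H_\varphi$ with $U'_s\pi_\varphi(x)\xi_\varphi=\pi_\varphi(\alpha_s(x))\xi_\varphi$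 for $x\in pAp$, so that $\theta'_t(\pi_\varphi(x))=\pi_\varphi(\alpha_{-\beta t}(x))$. Then there is a $*$-isomorphism $$\Phi:\ \pi_\varphi(pAp)''\ \longrightarrow\ \pi_\psi(p)\,\pi_\psi(A)''\,\pi_\psi(p)$$ such that $\Phi\circ\theta'_t=\theta_t\circ\Phi$ for all $t\in\mathbb R$. -/

import Mathlib

open scoped ENNReal InnerProductSpace Topology

noncomputable section

namespace KMSCorner

/-- A weight on a C⋆-algebra `A`: an additive, positively homogeneous map from the cone `A₊` of
positive elements to `[0, ∞]`. Homogeneity for `r = 0` (with `0 * ∞ = 0`) says `ψ 0 = 0`, which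
excludes only the constant `∞`, a map that is not densely defined. -/
structure Weight (A : Type*) [NonUnitalCStarAlgebra A] [PartialOrder A] [StarOrderedRing A] where
  toFun : {a : A // 0 ≤ a} → ℝ≥0∞
  map_add : ∀ a b : {a : A // 0 ≤ a}, toFun (a + b) = toFun a + toFun b
  map_smul : ∀ (r : ℝ) (hr : 0 ≤ r) (a : {a : A // 0 ≤ a}),
    toFun ⟨r • (a : A), smul_nonneg hr a.2⟩ = ENNReal.ofReal r * toFun a

namespace Weight

variable {A : Type*} [NonUnitalCStarAlgebra A] [PartialOrder A] [StarOrderedRing A]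

instance : CoeFun (Weight A) (fun _ => {a : A // 0 ≤ a} → ℝ≥0∞) := ⟨toFun⟩

/-- A weight is proper when it is non-zero, densely defined and lower semi-continuous. -/
structure IsProper (ψ : Weight A) : Prop where
  ne_zero : ∃ a, ψ a ≠ 0
  dense : Dense {a : {a : A // 0 ≤ a} | ψ a < ∞}
  closed : ∀ r : ℝ, 0 ≤ r → IsClosed {a : {a : A // 0 ≤ a} | ψ a ≤ ENNReal.ofReal r}

theorem mono (ψ : Weight A) {a b : A} (ha : 0 ≤ a) (hb : 0 ≤ b) (h : a ≤ b) :
    ψ ⟨a, ha⟩ ≤ ψ ⟨b, hb⟩ := by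
  have : (⟨b, hb⟩ : {a : A // 0 ≤ a}) = ⟨a, ha⟩ + ⟨b - a, sub_nonneg.2 h⟩ := by
    ext; simp
  rw [this, ψ.map_add]
  exact le_self_add

/-- The positive elements of finite weight, as a subset of `A`. -/
def finitePos (ψ : Weight A) : Set A := {a | ∃ h : 0 ≤ a, ψ ⟨a, h⟩ < ∞}

theorem finitePos_of_le (ψ : Weight A) {a b : A} (ha : 0 ≤ a) (h : a ≤ b)
    (hb : b ∈ ψ.finitePos) : a ∈ ψ.finitePos :=
  ⟨ha, (ψ.mono ha hb.1 h).trans_lt hb.2⟩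

theorem finitePos_add (ψ : Weight A) {a b : A} (ha : a ∈ ψ.finitePos) (hb : b ∈ ψ.finitePos) :
    a + b ∈ ψ.finitePos :=
  ⟨add_nonneg ha.1 hb.1, (ψ.map_add ⟨a, ha.1⟩ ⟨b, hb.1⟩).trans_lt
    (ENNReal.add_lt_top.2 ⟨ha.2, hb.2⟩)⟩

theorem finitePos_smul (ψ : Weight A) {a : A} {r : ℝ} (hr : 0 ≤ r) (ha : a ∈ ψ.finitePos) :
    r • a ∈ ψ.finitePos :=
  ⟨smul_nonneg hr ha.1,
    (ψ.map_smul r hr ⟨a, ha.1⟩).trans_lt (ENNReal.mul_lt_top ENNReal.ofReal_lt_top ha.2)⟩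

theorem star_add_mul_le (a b : A) :
    star (a + b) * (a + b) ≤ (2 : ℝ) • (star a * a + star b * b) := by
  rw [← sub_nonneg]
  have : (2 : ℝ) • (star a * a + star b * b) - star (a + b) * (a + b)
      = star (a - b) * (a - b) := by
    rw [two_smul, star_add, star_sub]; noncomm_ring
  rw [this]; exact star_mul_self_nonneg _

/-- `𝒩_ψ = {a ∈ A : ψ(a⋆a) < ∞}`, as a linear subspace of `A`. -/
def N (ψ : Weight A) : Submodule ℂ A where
  carrier := {a | ψ ⟨star a * a, star_mul_self_nonneg a⟩ < ∞}
  zero_mem' := by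
    have h := ψ.map_smul 0 le_rfl ⟨0, le_rfl⟩
    simp only [zero_smul, ENNReal.ofReal_zero, zero_mul] at h
    simp [h]
  add_mem' {a b} ha hb := by
    exact (ψ.finitePos_of_le (star_mul_self_nonneg _) (star_add_mul_le a b)
      (ψ.finitePos_smul zero_le_two (ψ.finitePos_add ⟨_, ha⟩ ⟨_, hb⟩))).2
  smul_mem' c a ha := by
    have h := ψ.finitePos_smul (sq_nonneg ‖c‖) ⟨star_mul_self_nonneg a, ha⟩
    have e : star (c • a) * (c • a) = (‖c‖ ^ 2 : ℝ) • (star a * a) := by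
      rw [star_smul, smul_mul_smul_comm, ← Complex.coe_smul, Complex.star_def,
        mul_comm, Complex.mul_conj, Complex.normSq_eq_norm_sq]
    have h2 : star (c • a) * (c • a) ∈ ψ.finitePos := e ▸ h
    exact h2.2

theorem mem_N {ψ : Weight A} {a : A} :
    a ∈ ψ.N ↔ ψ ⟨star a * a, star_mul_self_nonneg a⟩ < ∞ := Iff.rfl

theorem mem_N' {ψ : Weight A} {a : A} : a ∈ ψ.N ↔ star a * a ∈ ψ.finitePos :=
  ⟨fun h => ⟨_, h⟩, fun h => h.2⟩

theorem mul_mem_N (ψ : Weight A) (a : A) {b : A} (hb : b ∈ ψ.N) : a * b ∈ ψ.N := by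
  rw [mem_N'] at hb ⊢
  refine ψ.finitePos_of_le (star_mul_self_nonneg _) ?_
    (ψ.finitePos_smul (norm_nonneg (star a * a)) hb)
  rw [star_mul, mul_assoc, ← mul_assoc (star a), ← mul_assoc]
  exact CStarAlgebra.star_left_conjugate_le_norm_smul

/-- `𝒩_ψ⋆ 𝒩_ψ = Span {a⋆b : a, b ∈ 𝒩_ψ}`. -/
def domain (ψ : Weight A) : Submodule ℂ A :=
  Submodule.span ℂ {x | ∃ a ∈ ψ.N, ∃ b ∈ ψ.N, x = star a * b}

theorem mul_mem_domain (ψ : Weight A) {a b : A} (ha : a ∈ ψ.N) (hb : b ∈ ψ.N) :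
    star a * b ∈ ψ.domain :=
  Submodule.subset_span ⟨a, ha, b, hb, rfl⟩

theorem finitePos_subset_domain (ψ : Weight A) {a : A} (ha : a ∈ ψ.finitePos) :
    a ∈ ψ.domain := by
  obtain ⟨s, rfl⟩ := CStarAlgebra.nonneg_iff_eq_star_mul_self.1 ha.1
  exact ψ.mul_mem_domain ha.2 ha.2

/-- `x = (a - b) + i (c - d)` with `a, b, c, d ≥ 0` of finite weight, and
`z = (ψ a - ψ b) + i (ψ c - ψ d)`. -/
def HasVal (ψ : Weight A) (x : A) (z : ℂ) : Prop :=
  ∃ a b c d : {a : A // 0 ≤ a}, ψ a < ∞ ∧ ψ b < ∞ ∧ ψ c < ∞ ∧ ψ d < ∞ ∧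
    x = ((a : A) - b) + Complex.I • ((c : A) - d) ∧
    z = (((ψ a).toReal - (ψ b).toReal : ℝ) : ℂ)
      + Complex.I * (((ψ c).toReal - (ψ d).toReal : ℝ) : ℂ)

theorem toReal_add (ψ : Weight A) {a b : {a : A // 0 ≤ a}} (ha : ψ a < ∞) (hb : ψ b < ∞) :
    (ψ (a + b)).toReal = (ψ a).toReal + (ψ b).toReal := by
  rw [ψ.map_add, ENNReal.toReal_add ha.ne hb.ne]

theorem add_lt_top (ψ : Weight A) {a b : {a : A // 0 ≤ a}} (ha : ψ a < ∞) (hb : ψ b < ∞) :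
    ψ (a + b) < ∞ := by
  rw [ψ.map_add]; exact ENNReal.add_lt_top.2 ⟨ha, hb⟩

theorem sub_eq_sub (ψ : Weight A) {a b a' b' : {a : A // 0 ≤ a}} (ha : ψ a < ∞) (hb : ψ b < ∞)
    (ha' : ψ a' < ∞) (hb' : ψ b' < ∞) (h : (a : A) - b = a' - b') :
    (ψ a).toReal - (ψ b).toReal = (ψ a').toReal - (ψ b').toReal := by
  have : a + b' = a' + b := by ext; simpa using sub_eq_sub_iff_add_eq_add.1 h
  have := congrArg (fun x => (ψ x).toReal) this
  simp only [ψ.toReal_add, ha, hb, ha', hb'] at this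
  linarith

theorem star_pos (a : {a : A // 0 ≤ a}) : star (a : A) = a := (IsSelfAdjoint.of_nonneg a.2)

theorem re_im_unique {a b c d a' b' c' d' : {a : A // 0 ≤ a}}
    (h : ((a : A) - b) + Complex.I • ((c : A) - d) = ((a' : A) - b') + Complex.I • ((c' : A) - d')) :
    (a : A) - b = a' - b' ∧ (c : A) - d = c' - d' := by
  have h' := congrArg star h
  simp only [star_add, star_sub, star_smul, star_pos, Complex.star_def, Complex.conj_I] at h'
  have h1 : (a : A) - b = a' - b' := by
    have h3 : (2 : ℂ) • ((a : A) - b) = (2 : ℂ) • ((a' : A) - b') := by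
      have h4 := congrArg₂ (· + ·) h h'
      simp only [neg_smul] at h4
      rw [two_smul, two_smul]
      convert h4 using 1 <;> abel
    exact smul_right_injective A (two_ne_zero' ℂ) h3
  refine ⟨h1, ?_⟩
  rw [h1] at h
  exact smul_right_injective A Complex.I_ne_zero (add_left_cancel h)

theorem HasVal.unique {ψ : Weight A} {x : A} {z w : ℂ} (h : ψ.HasVal x z) (h' : ψ.HasVal x w) :
    z = w := by
  obtain ⟨a, b, c, d, ha, hb, hc, hd, hx, rfl⟩ := h
  obtain ⟨a', b', c', d', ha', hb', hc', hd', hx', rfl⟩ := h'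
  obtain ⟨h1, h2⟩ := re_im_unique (hx.symm.trans hx')
  rw [ψ.sub_eq_sub ha hb ha' hb' h1, ψ.sub_eq_sub hc hd hc' hd' h2]

theorem HasVal.add {ψ : Weight A} {x y : A} {z w : ℂ} (h : ψ.HasVal x z) (h' : ψ.HasVal y w) :
    ψ.HasVal (x + y) (z + w) := by
  obtain ⟨a, b, c, d, ha, hb, hc, hd, rfl, rfl⟩ := h
  obtain ⟨a', b', c', d', ha', hb', hc', hd', rfl, rfl⟩ := h'
  refine ⟨a + a', b + b', c + c', d + d', ψ.add_lt_top ha ha', ψ.add_lt_top hb hb',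
    ψ.add_lt_top hc hc', ψ.add_lt_top hd hd', ?_, ?_⟩
  · simp only [Nonneg.coe_add, smul_sub, smul_add]; abel
  · simp only [ψ.toReal_add, ha, hb, hc, hd, ha', hb', hc', hd']; push_cast; ring

theorem HasVal.neg {ψ : Weight A} {x : A} {z : ℂ} (h : ψ.HasVal x z) :
    ψ.HasVal (-x) (-z) := by
  obtain ⟨a, b, c, d, ha, hb, hc, hd, rfl, rfl⟩ := h
  refine ⟨b, a, d, c, hb, ha, hd, hc, ?_, ?_⟩
  · simp only [smul_sub]; abel
  · push_cast; ring

theorem HasVal.I_smul {ψ : Weight A} {x : A} {z : ℂ} (h : ψ.HasVal x z) :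
    ψ.HasVal (Complex.I • x) (Complex.I * z) := by
  obtain ⟨a, b, c, d, ha, hb, hc, hd, rfl, rfl⟩ := h
  refine ⟨d, c, a, b, hd, hc, ha, hb, ?_, ?_⟩
  · rw [smul_add, smul_smul, Complex.I_mul_I]; simp only [smul_sub, neg_smul, one_smul]; abel
  · push_cast; ring_nf; simp only [Complex.I_sq]; ring

theorem HasVal.nonneg_smul {ψ : Weight A} {x : A} {z : ℂ} (h : ψ.HasVal x z) {r : ℝ}
    (hr : 0 ≤ r) : ψ.HasVal ((r : ℂ) • x) (r * z) := by
  obtain ⟨a, b, c, d, ha, hb, hc, hd, rfl, rfl⟩ := h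
  refine ⟨⟨r • (a : A), smul_nonneg hr a.2⟩, ⟨r • (b : A), smul_nonneg hr b.2⟩,
    ⟨r • (c : A), smul_nonneg hr c.2⟩, ⟨r • (d : A), smul_nonneg hr d.2⟩,
    (ψ.finitePos_smul hr ⟨_, ha⟩).2, (ψ.finitePos_smul hr ⟨_, hb⟩).2,
    (ψ.finitePos_smul hr ⟨_, hc⟩).2, (ψ.finitePos_smul hr ⟨_, hd⟩).2, ?_, ?_⟩
  · simp only [← Complex.coe_smul, smul_sub, smul_add]
    simp only [smul_comm Complex.I (r : ℂ)]
  · simp only [ψ.map_smul r hr, ENNReal.toReal_mul, ENNReal.toReal_ofReal hr]; push_cast; ring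

theorem HasVal.real_smul {ψ : Weight A} {x : A} {z : ℂ} (h : ψ.HasVal x z) (r : ℝ) :
    ψ.HasVal ((r : ℂ) • x) (r * z) := by
  rcases le_total 0 r with hr | hr
  · exact h.nonneg_smul hr
  · simpa using (h.nonneg_smul (neg_nonneg.2 hr)).neg

theorem HasVal.smul {ψ : Weight A} {x : A} {z : ℂ} (h : ψ.HasVal x z) (c : ℂ) :
    ψ.HasVal (c • x) (c * z) := by
  have := (h.real_smul c.re).add (h.real_smul c.im).I_smul
  rw [smul_smul, ← add_smul, ← mul_assoc, ← add_mul, mul_comm Complex.I, Complex.re_add_im] at this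
  exact this

theorem hasVal_of_finite (ψ : Weight A) {a : {a : A // 0 ≤ a}} (ha : ψ a < ∞) :
    ψ.HasVal (a : A) ((ψ a).toReal : ℂ) := by
  have h := ψ.map_smul 0 le_rfl ⟨0, le_rfl⟩
  simp only [zero_smul, ENNReal.ofReal_zero, zero_mul] at h
  exact ⟨a, ⟨0, le_rfl⟩, ⟨0, le_rfl⟩, ⟨0, le_rfl⟩, ha, by simp [h], by simp [h], by simp [h],
    by simp, by simp [h]⟩

theorem exists_hasVal (ψ : Weight A) {x : A} (hx : x ∈ ψ.domain) : ∃ z, ψ.HasVal x z := by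
  induction hx using Submodule.span_induction with
  | mem x hx =>
    obtain ⟨a, ha, b, hb, rfl⟩ := hx
    have key : ∀ c : ℂ, ∃ z, ψ.HasVal (star (a + c • b) * (a + c • b)) z := fun c =>
      ⟨_, ψ.hasVal_of_finite (ψ.N.add_mem ha (ψ.N.smul_mem c hb))⟩
    obtain ⟨z1, h1⟩ := key 1
    obtain ⟨z2, h2⟩ := key (-1)
    obtain ⟨z3, h3⟩ := key Complex.I
    obtain ⟨z4, h4⟩ := key (-Complex.I)
    have := (((h1.add h2.neg).add (h3.smul (-Complex.I))).add (h4.smul Complex.I)).smul (1 / 4)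
    refine ⟨1 / 4 * (z1 + -z2 + -Complex.I * z3 + Complex.I * z4), ?_⟩
    convert this using 1
    simp only [star_add, star_smul, mul_add, add_mul, smul_mul_assoc, mul_smul_comm,
      Complex.star_def, map_neg, Complex.conj_I, map_one]
    match_scalars <;> ring_nf <;> simp only [Complex.I_sq] <;> ring
  | zero => exact ⟨_, by simpa using (ψ.hasVal_of_finite (a := ⟨0, le_rfl⟩) (by
      have h := ψ.map_smul 0 le_rfl ⟨0, le_rfl⟩
      simp only [zero_smul, ENNReal.ofReal_zero, zero_mul] at h
      simp [h]))⟩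
  | add x y _ _ hx hy => exact ⟨_, hx.choose_spec.add hy.choose_spec⟩
  | smul c x _ hx => exact ⟨_, hx.choose_spec.smul c⟩

theorem finitePos_of_mem_domain (ψ : Weight A) (a : {a : A // 0 ≤ a}) (ha : (a : A) ∈ ψ.domain) :
    ψ a < ∞ := by
  obtain ⟨z, b, c, d, e, hb, hc, hd, he, hx, -⟩ := ψ.exists_hasVal ha
  have h0 : (a : A) - (0 : A) + Complex.I • ((0 : A) - 0) = b - c + Complex.I • ((d : A) - e) := by
    simpa using hx
  have h1 := (re_im_unique (a := a) (b := ⟨0, le_rfl⟩) (c := ⟨0, le_rfl⟩) (d := ⟨0, le_rfl⟩) h0).1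
  simp only [sub_zero] at h1
  exact (ψ.mono a.2 b.2 (by rw [h1]; exact sub_le_self _ c.2)).trans_lt hb

/-- There is a unique linear functional on `𝒩_ψ⋆ 𝒩_ψ` which extends
`ψ : 𝒩_ψ⋆ 𝒩_ψ ∩ A₊ → [0, ∞)`. -/
theorem existsUnique_linearExtension (ψ : Weight A) :
    ∃! f : ψ.domain →ₗ[ℂ] ℂ, ∀ (a : {a : A // 0 ≤ a}) (ha : (a : A) ∈ ψ.domain),
      ψ a < ∞ ∧ f ⟨a, ha⟩ = ((ψ a).toReal : ℂ) := by
  choose v hv using fun x : ψ.domain => ψ.exists_hasVal x.2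
  refine ⟨{ toFun := v, map_add' := ?_, map_smul' := ?_ }, ?_, ?_⟩
  · exact fun x y => (hv (x + y)).unique ((hv x).add (hv y))
  · exact fun c x => (hv (c • x)).unique ((hv x).smul c)
  · intro a ha
    have := ψ.finitePos_of_mem_domain a ha
    exact ⟨this, (hv ⟨a, ha⟩).unique (ψ.hasVal_of_finite this)⟩
  · intro g hg
    ext x
    refine HasVal.unique ?_ (hv x)
    obtain ⟨a, b, c, d, ha, hb, hc, hd, hx, hz⟩ := hv x
    refine ⟨a, b, c, d, ha, hb, hc, hd, hx, ?_⟩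
    have ma := ψ.finitePos_subset_domain ⟨a.2, ha⟩
    have mb := ψ.finitePos_subset_domain ⟨b.2, hb⟩
    have mc := ψ.finitePos_subset_domain ⟨c.2, hc⟩
    have md := ψ.finitePos_subset_domain ⟨d.2, hd⟩
    have : x = ((⟨a, ma⟩ : ψ.domain) - ⟨b, mb⟩) + Complex.I • ((⟨c, mc⟩ : ψ.domain) - ⟨d, md⟩) := by
      ext; simpa using hx
    rw [this]
    simp [(hg _ ma).2, (hg _ mb).2, (hg _ mc).2, (hg _ md).2]

/-- The linear functional on `𝒩_ψ⋆ 𝒩_ψ` extending `ψ`. -/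
def linearExtension (ψ : Weight A) : ψ.domain →ₗ[ℂ] ℂ := ψ.existsUnique_linearExtension.choose

theorem linearExtension_spec (ψ : Weight A) (a : {a : A // 0 ≤ a}) (ha : (a : A) ∈ ψ.domain) :
    ψ a < ∞ ∧ ψ.linearExtension ⟨a, ha⟩ = ((ψ a).toReal : ℂ) :=
  ψ.existsUnique_linearExtension.choose_spec.1 a ha

open Classical in
/-- The value `ψ(x)` of the linear extension of `ψ` at `x ∈ 𝒩_ψ⋆ 𝒩_ψ` (and `0` elsewhere, where
`ψ` is not defined). -/
def ext (ψ : Weight A) (x : A) : ℂ := if hx : x ∈ ψ.domain then ψ.linearExtension ⟨x, hx⟩ else 0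

theorem HasVal.mem_domain {ψ : Weight A} {x : A} {z : ℂ} (h : ψ.HasVal x z) : x ∈ ψ.domain := by
  obtain ⟨a, b, c, d, ha, hb, hc, hd, rfl, -⟩ := h
  exact ψ.domain.add_mem
    (ψ.domain.sub_mem (ψ.finitePos_subset_domain ⟨a.2, ha⟩) (ψ.finitePos_subset_domain ⟨b.2, hb⟩))
    (ψ.domain.smul_mem _
      (ψ.domain.sub_mem (ψ.finitePos_subset_domain ⟨c.2, hc⟩)
        (ψ.finitePos_subset_domain ⟨d.2, hd⟩)))

theorem HasVal.ext_eq {ψ : Weight A} {x : A} {z : ℂ} (h : ψ.HasVal x z) : ψ.ext x = z := by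
  have hx := h.mem_domain
  obtain ⟨a, b, c, d, ha, hb, hc, hd, e, rfl⟩ := h
  have ma := ψ.finitePos_subset_domain ⟨a.2, ha⟩
  have mb := ψ.finitePos_subset_domain ⟨b.2, hb⟩
  have mc := ψ.finitePos_subset_domain ⟨c.2, hc⟩
  have md := ψ.finitePos_subset_domain ⟨d.2, hd⟩
  have : (⟨x, hx⟩ : ψ.domain)
      = ((⟨a, ma⟩ : ψ.domain) - ⟨b, mb⟩) + Complex.I • ((⟨c, mc⟩ : ψ.domain) - ⟨d, md⟩) := by
    ext; simpa using e
  rw [ext, dif_pos hx, this]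
  simp [(ψ.linearExtension_spec _ ma).2, (ψ.linearExtension_spec _ mb).2,
    (ψ.linearExtension_spec _ mc).2, (ψ.linearExtension_spec _ md).2]

theorem ext_hasVal (ψ : Weight A) {x : A} (hx : x ∈ ψ.domain) : ψ.HasVal x (ψ.ext x) := by
  obtain ⟨z, hz⟩ := ψ.exists_hasVal hx
  rwa [hz.ext_eq]

end Weight

/-! ### One-parameter groups, KMS weights -/

/-- A point-wise norm-continuous one-parameter group of ⋆-automorphisms. -/
structure OneParamGroup (B : Type*) [Mul B] [Add B] [Star B] [SMul ℂ B] [TopologicalSpace B] where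
  toFun : ℝ → (B ≃⋆ₐ[ℂ] B)
  map_add : ∀ s t, toFun (s + t) = toFun s * toFun t
  continuous : ∀ b, Continuous fun t => toFun t b

instance {B : Type*} [Mul B] [Add B] [Star B] [SMul ℂ B] [TopologicalSpace B] :
    CoeFun (OneParamGroup B) (fun _ => ℝ → (B ≃⋆ₐ[ℂ] B)) := ⟨OneParamGroup.toFun⟩

/-- The closed strip of the complex numbers whose imaginary part lies between `0` and `β`. -/
def strip (β : ℝ) : Set ℂ := {z | z.im ∈ Set.uIcc 0 β}

namespace Weight

variable {A : Type*} [NonUnitalCStarAlgebra A] [PartialOrder A] [StarOrderedRing A]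

/-- `ψ ∘ σ = ψ`. -/
def IsInvariant (ψ : Weight A) (σ : A ≃⋆ₐ[ℂ] A) : Prop :=
  ∀ a : {a : A // 0 ≤ a}, ψ ⟨σ a, map_nonneg σ a.2⟩ = ψ a

/-- `ψ` is a `β`-KMS weight for `α`. -/
structure IsKMS (ψ : Weight A) (α : OneParamGroup A) (β : ℝ) : Prop where
  isProper : ψ.IsProper
  invariant : ∀ t, ψ.IsInvariant (α t)
  kms : ∀ a b : A, a ∈ ψ.N → star a ∈ ψ.N → b ∈ ψ.N → star b ∈ ψ.N →
    ∃ F : ℂ → ℂ, ContinuousOn F (strip β) ∧ (∃ C : ℝ, ∀ z ∈ strip β, ‖F z‖ ≤ C) ∧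
      DifferentiableOn ℂ F (interior (strip β)) ∧
      ∀ t : ℝ, F t = ψ.ext (a * α t b) ∧ F (t + β * Complex.I) = ψ.ext (α t b * a)

theorem IsInvariant.mem_N {ψ : Weight A} {σ : A ≃⋆ₐ[ℂ] A} (h : ψ.IsInvariant σ) {a : A} :
    σ a ∈ ψ.N ↔ a ∈ ψ.N := by
  have := h ⟨star a * a, star_mul_self_nonneg a⟩
  simp only [map_mul, map_star] at this
  rw [Weight.mem_N, Weight.mem_N, this]

theorem IsInvariant.hasVal {ψ : Weight A} {σ : A ≃⋆ₐ[ℂ] A} (h : ψ.IsInvariant σ) {x : A} {z : ℂ}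
    (hx : ψ.HasVal x z) : ψ.HasVal (σ x) z := by
  obtain ⟨a, b, c, d, ha, hb, hc, hd, rfl, rfl⟩ := hx
  exact ⟨⟨σ a, map_nonneg σ a.2⟩, ⟨σ b, map_nonneg σ b.2⟩, ⟨σ c, map_nonneg σ c.2⟩,
    ⟨σ d, map_nonneg σ d.2⟩, by rwa [h a], by rwa [h b], by rwa [h c], by rwa [h d],
    by simp, by rw [h a, h b, h c, h d]⟩

theorem IsInvariant.symm {ψ : Weight A} {σ : A ≃⋆ₐ[ℂ] A} (h : ψ.IsInvariant σ) :
    ψ.IsInvariant σ.symm := by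
  intro a
  rw [← h ⟨σ.symm a, map_nonneg σ.symm a.2⟩]
  simp

theorem IsInvariant.ext_apply {ψ : Weight A} {σ : A ≃⋆ₐ[ℂ] A} (h : ψ.IsInvariant σ) (x : A) :
    ψ.ext (σ x) = ψ.ext x := by
  by_cases hx : x ∈ ψ.domain
  · exact (h.hasVal (ψ.ext_hasVal hx)).ext_eq
  · have hx' : σ x ∉ ψ.domain := fun h' => hx <| by
      simpa using (h.symm.hasVal (ψ.ext_hasVal h')).mem_domain
    rw [ext, ext, dif_neg hx, dif_neg hx']

end Weight

/-! ### Corners -/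

section Corner

variable {R : Type*} [NonUnitalRing R] [StarRing R] [Module ℂ R] [IsScalarTower ℂ R R]
  [SMulCommClass ℂ R R]

/-- The corner `pRp = {p a p : a ∈ R}` of a projection `p`. -/
def corner (p : R) (hp : IsStarProjection p) : NonUnitalStarSubalgebra ℂ R where
  carrier := {x | ∃ a, x = p * a * p}
  add_mem' := by
    rintro _ _ ⟨a, rfl⟩ ⟨b, rfl⟩
    exact ⟨a + b, by rw [mul_add, add_mul]⟩
  zero_mem' := ⟨0, by simp⟩
  mul_mem' := by
    rintro _ _ ⟨a, rfl⟩ ⟨b, rfl⟩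
    exact ⟨a * p * (p * b), by simp only [mul_assoc]⟩
  smul_mem' := by
    rintro c _ ⟨a, rfl⟩
    exact ⟨c • a, by rw [mul_smul_comm, smul_mul_assoc]⟩
  star_mem' := by
    rintro _ ⟨a, rfl⟩
    exact ⟨star a, by simp only [star_mul, hp.isSelfAdjoint.star_eq, mul_assoc]⟩

theorem map_mem_corner {p : R} {hp : IsStarProjection p} (σ : R ≃⋆ₐ[ℂ] R) (hσ : σ p = p) {x : R}
    (hx : x ∈ corner p hp) : σ x ∈ corner p hp := by
  obtain ⟨a, rfl⟩ := hx
  exact ⟨σ a, by rw [map_mul, map_mul, hσ]⟩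

/-- The restriction to the corner `pRp` of an automorphism that fixes `p`. -/
def restrictCorner (p : R) (hp : IsStarProjection p) (σ : R ≃⋆ₐ[ℂ] R) (hσ : σ p = p) :
    corner p hp ≃⋆ₐ[ℂ] corner p hp where
  toFun x := ⟨σ x, map_mem_corner σ hσ x.2⟩
  invFun x := ⟨σ.symm x, map_mem_corner σ.symm ((StarAlgEquiv.symm_apply_eq σ).2 hσ.symm) x.2⟩
  left_inv x := by ext; simp
  right_inv x := by ext; simp
  map_mul' x y := by ext; simp
  map_add' x y := by ext; simp
  map_star' x := Subtype.ext (map_star σ (x : R))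
  map_smul' c x := by ext; simp

/-- The restriction to the corner `pRp` of a one-parameter group that fixes `p`. -/
def OneParamGroup.restrictCorner [TopologicalSpace R] (α : OneParamGroup R) (p : R)
    (hp : IsStarProjection p) (hαp : ∀ t, α t p = p) : OneParamGroup (corner p hp) where
  toFun t := KMSCorner.restrictCorner p hp (α t) (hαp t)
  map_add s t := by
    apply StarAlgEquiv.ext
    intro x
    apply Subtype.ext
    exact DFunLike.congr_fun (α.map_add s t) (x : R)
  continuous x := (α.continuous (x : R)).subtype_mk _

/-- The projection `p` is full: the closed two-sided ideal generated by `p` is everything. -/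
def IsFull [TopologicalSpace R] (p : R) : Prop :=
  Dense (Submodule.span ℂ {x : R | ∃ a b, x = a * p * b} : Set R)

end Corner

/-! ### Bicommutants -/

section Bicommutant

variable {B : Type*} [NonUnitalRing B] [StarRing B] [Module ℂ B]
variable {H : Type*} [NormedAddCommGroup H] [InnerProductSpace ℂ H] [CompleteSpace H]

/-- The von Neumann algebra `π(B)''`. -/
def bicommutant (π : B →⋆ₙₐ[ℂ] (H →L[ℂ] H)) : StarSubalgebra ℂ (H →L[ℂ] H) :=
  StarSubalgebra.centralizer ℂ (StarSubalgebra.centralizer ℂ (Set.range π) : Set (H →L[ℂ] H))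

theorem mem_bicommutant (π : B →⋆ₙₐ[ℂ] (H →L[ℂ] H)) (b : B) : π b ∈ bicommutant π := by
  rw [bicommutant, StarSubalgebra.mem_centralizer_iff]
  intro g hg
  have hg' := star_mem hg
  rw [SetLike.mem_coe] at hg
  rw [StarSubalgebra.mem_centralizer_iff] at hg hg'
  exact ⟨((hg _ ⟨b, rfl⟩).1).symm, ((hg' _ ⟨b, rfl⟩).1).symm⟩

theorem isStarProjection_bicommutant (π : B →⋆ₙₐ[ℂ] (H →L[ℂ] H)) {p : B}
    (hp : IsStarProjection p) :
    IsStarProjection (⟨π p, mem_bicommutant π p⟩ : bicommutant π) where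
  isIdempotentElem := by
    apply Subtype.ext
    change π p * π p = π p
    rw [← map_mul, hp.isIdempotentElem.eq]
  isSelfAdjoint := by
    apply Subtype.ext
    change star (π p) = π p
    rw [← map_star, hp.isSelfAdjoint.star_eq]

theorem map_mem_centralizer {R : Type*} [Ring R] [StarRing R] [Algebra ℂ R] [StarModule ℂ R]
    (e : R ≃⋆ₐ[ℂ] R) {s : Set R} (hs : ∀ g ∈ s, e.symm g ∈ s) {x : R}
    (hx : x ∈ StarSubalgebra.centralizer ℂ s) : e x ∈ StarSubalgebra.centralizer ℂ s := by
  rw [StarSubalgebra.mem_centralizer_iff] at hx ⊢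
  intro g hg
  obtain ⟨h1, h2⟩ := hx _ (hs g hg)
  have h1' := congrArg e h1
  have h2' := congrArg e h2
  simp only [map_mul, map_star, StarAlgEquiv.apply_symm_apply] at h1' h2'
  exact ⟨h1', h2'⟩

theorem conj_mem_bicommutant {π : B →⋆ₙₐ[ℂ] (H →L[ℂ] H)} {σ : B ≃⋆ₐ[ℂ] B} {e : (H →L[ℂ] H) ≃⋆ₐ[ℂ] (H →L[ℂ] H)}
    (h : ∀ b, e (π b) = π (σ b)) {x : H →L[ℂ] H} (hx : x ∈ bicommutant π) :
    e x ∈ bicommutant π := by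
  refine map_mem_centralizer e (fun g hg => map_mem_centralizer e.symm ?_ hg) hx
  rintro _ ⟨b, rfl⟩
  exact ⟨σ b, by simpa using (h b).symm⟩

/-- If a unitary `u` on `H` implements the automorphism `σ` of `B`, i.e. `u π(b) u⋆ = π(σ(b))`,
then `Ad u` restricts to an automorphism of `π(B)''`. -/
def adBicommutant (π : B →⋆ₙₐ[ℂ] (H →L[ℂ] H)) (σ : B ≃⋆ₐ[ℂ] B) (u : H ≃ₗᵢ[ℂ] H)
    (h : ∀ b, u.conjStarAlgEquiv (π b) = π (σ b)) : bicommutant π ≃⋆ₐ[ℂ] bicommutant π where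
  toFun x := ⟨u.conjStarAlgEquiv x, conj_mem_bicommutant h x.2⟩
  invFun x := ⟨u.conjStarAlgEquiv.symm x, conj_mem_bicommutant (σ := σ.symm)
    (fun b => by rw [StarAlgEquiv.symm_apply_eq, h]; simp) x.2⟩
  left_inv x := by ext; simp
  right_inv x := by ext; simp
  map_mul' x y := Subtype.ext (map_mul u.conjStarAlgEquiv _ _)
  map_add' x y := Subtype.ext (map_add u.conjStarAlgEquiv _ _)
  map_star' x := Subtype.ext (map_star u.conjStarAlgEquiv _)
  map_smul' c x := Subtype.ext (map_smul u.conjStarAlgEquiv c _)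

end Bicommutant

/-! ### GNS representations and their modular groups -/

/-- A GNS construction of the weight `ψ` on the Hilbert space `H`. -/
structure Weight.GNS {A : Type*} [NonUnitalCStarAlgebra A] [PartialOrder A] [StarOrderedRing A]
    (ψ : Weight A) (H : Type*) [NormedAddCommGroup H] [InnerProductSpace ℂ H]
    [CompleteSpace H] where
  Λ : ψ.N →ₗ[ℂ] H
  π : A →⋆ₙₐ[ℂ] (H →L[ℂ] H)
  denseRange : DenseRange Λ
  nondegenerate : Dense (Submodule.span ℂ {η : H | ∃ a ζ, η = π a ζ} : Set H)
  inner_Λ : ∀ a b : ψ.N, ⟪Λ b, Λ a⟫_ℂ = ψ.ext (star (b : A) * a)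
  π_Λ : ∀ (a : A) (b : ψ.N), π a (Λ b) = Λ ⟨a * b, ψ.mul_mem_N a b.2⟩

namespace Weight.GNS

variable {A : Type*} [NonUnitalCStarAlgebra A] [PartialOrder A] [StarOrderedRing A]
  {ψ : Weight A} {H : Type*} [NormedAddCommGroup H] [InnerProductSpace ℂ H] [CompleteSpace H]

/-- The restriction to `𝒩_ψ` of an automorphism that preserves `ψ`. -/
def restrictN {σ : A ≃⋆ₐ[ℂ] A} (hσ : ψ.IsInvariant σ) : ψ.N ≃ₗ[ℂ] ψ.N where
  toFun a := ⟨σ a, hσ.mem_N.2 a.2⟩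
  invFun a := ⟨σ.symm a, hσ.symm.mem_N.2 a.2⟩
  left_inv a := by ext; simp
  right_inv a := by ext; simp
  map_add' a b := by ext; simp
  map_smul' c a := by ext; simp

theorem norm_Λ_restrictN (G : ψ.GNS H) {σ : A ≃⋆ₐ[ℂ] A} (hσ : ψ.IsInvariant σ) (a : ψ.N) :
    ‖G.Λ (restrictN hσ a)‖ = ‖G.Λ a‖ := by
  rw [← sq_eq_sq₀ (norm_nonneg _) (norm_nonneg _)]
  apply Complex.ofReal_injective
  have h1 := inner_self_eq_norm_sq_to_K (𝕜 := ℂ) (G.Λ (restrictN hσ a))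
  have h2 := inner_self_eq_norm_sq_to_K (𝕜 := ℂ) (G.Λ a)
  rw [G.inner_Λ] at h1 h2
  have h3 : ψ.ext (star (restrictN hσ a : A) * (restrictN hσ a : A))
      = ψ.ext (star (a : A) * a) := by
    rw [← hσ.ext_apply (star (a : A) * a)]
    simp [restrictN, map_star]
  rw [h1, h2] at h3
  exact_mod_cast h3

/-- The unitary `U` on `H_ψ` with `U Λ_ψ(a) = Λ_ψ(σ(a))`, for an automorphism `σ` that
preserves `ψ`. -/
def unitary (G : ψ.GNS H) {σ : A ≃⋆ₐ[ℂ] A} (hσ : ψ.IsInvariant σ) : H ≃ₗᵢ[ℂ] H :=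
  (restrictN hσ).extendOfIsometry G.Λ G.Λ G.denseRange G.denseRange (G.norm_Λ_restrictN hσ)

theorem unitary_Λ (G : ψ.GNS H) {σ : A ≃⋆ₐ[ℂ] A} (hσ : ψ.IsInvariant σ) (a : ψ.N) :
    G.unitary hσ (G.Λ a) = G.Λ ⟨σ a, hσ.mem_N.2 a.2⟩ :=
  LinearEquiv.extendOfIsometry_eq ..

theorem unitary_conj (G : ψ.GNS H) {σ : A ≃⋆ₐ[ℂ] A} (hσ : ψ.IsInvariant σ) (a : A) :
    (G.unitary hσ).conjStarAlgEquiv (G.π a) = G.π (σ a) := by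
  have key : ∀ η, G.unitary hσ (G.π a η) = G.π (σ a) (G.unitary hσ η) := by
    refine fun η => G.denseRange.induction ?_ (isClosed_eq (by fun_prop) (by fun_prop)) η
    rintro _ ⟨b, rfl⟩
    rw [G.π_Λ, G.unitary_Λ, G.unitary_Λ, G.π_Λ]
    simp
  ext η
  rw [LinearIsometryEquiv.conjStarAlgEquiv_apply_apply, key, LinearIsometryEquiv.apply_symm_apply]

/-- The modular group `θ_t = Ad U_{-βt}` on `π_ψ(A)''` of a `β`-KMS weight `ψ` for `α`, where
`U_s Λ_ψ(a) = Λ_ψ(α_s(a))`. -/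
def modularGroup (G : ψ.GNS H) {α : OneParamGroup A} {β : ℝ} (hψ : ψ.IsKMS α β) (t : ℝ) :
    bicommutant G.π ≃⋆ₐ[ℂ] bicommutant G.π :=
  adBicommutant G.π (α (-β * t)) (G.unitary (hψ.invariant (-β * t)))
    (G.unitary_conj (hψ.invariant (-β * t)))

end Weight.GNS

/-! ### Existence of the GNS construction of a proper weight -/

namespace Weight

variable {A : Type*} [NonUnitalCStarAlgebra A] [PartialOrder A] [StarOrderedRing A]

theorem ext_add (ψ : Weight A) {x y : A} (hx : x ∈ ψ.domain) (hy : y ∈ ψ.domain) :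
    ψ.ext (x + y) = ψ.ext x + ψ.ext y :=
  ((ψ.ext_hasVal hx).add (ψ.ext_hasVal hy)).ext_eq

theorem ext_smul (ψ : Weight A) (c : ℂ) {x : A} (hx : x ∈ ψ.domain) :
    ψ.ext (c • x) = c * ψ.ext x :=
  ((ψ.ext_hasVal hx).smul c).ext_eq

theorem ext_pos (ψ : Weight A) {a : A} (ha : a ∈ ψ.finitePos) :
    ψ.ext a = ((ψ ⟨a, ha.1⟩).toReal : ℂ) :=
  (ψ.hasVal_of_finite (a := ⟨a, ha.1⟩) ha.2).ext_eq

theorem ext_star (ψ : Weight A) {x : A} (hx : x ∈ ψ.domain) :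
    ψ.ext (star x) = star (ψ.ext x) := by
  obtain ⟨a, b, c, d, ha, hb, hc, hd, rfl, hz⟩ := ψ.ext_hasVal hx
  rw [hz]
  refine HasVal.ext_eq ⟨a, b, d, c, ha, hb, hd, hc, ?_, ?_⟩
  · simp only [star_add, star_sub, star_smul, star_pos, Complex.star_def, Complex.conj_I, smul_sub,
      neg_smul]
    abel
  · simp only [Complex.star_def, _root_.map_add, map_mul, Complex.conj_I, Complex.conj_ofReal]
    push_cast
    ring

/-- The space `𝒩_ψ`, to be equipped with the semi-inner product `(a, b) ↦ ψ(a⋆b)`. -/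
def PreGNS (ψ : Weight A) : Type _ := ψ.N

instance (ψ : Weight A) : AddCommGroup ψ.PreGNS := inferInstanceAs (AddCommGroup ψ.N)
instance (ψ : Weight A) : Module ℂ ψ.PreGNS := inferInstanceAs (Module ℂ ψ.N)

/-- The identity map `𝒩_ψ → 𝒩_ψ`. -/
def toPreGNS (ψ : Weight A) : ψ.N ≃ₗ[ℂ] ψ.PreGNS := LinearEquiv.refl ℂ _

/-- The semi-inner product `(a, b) ↦ ψ(a⋆b)` on `𝒩_ψ`. -/
abbrev preGNSCore (ψ : Weight A) : PreInnerProductSpace.Core ℂ ψ.PreGNS where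
  inner a b := ψ.ext (star (ψ.toPreGNS.symm a : A) * ψ.toPreGNS.symm b)
  conj_inner_symm a b := by
    have := ψ.ext_star
      (ψ.mul_mem_domain (ψ.toPreGNS.symm b).2 (ψ.toPreGNS.symm a).2)
    rw [star_mul, star_star] at this
    exact this.symm
  re_inner_nonneg a := by
    rw [ψ.ext_pos (mem_N'.1 (ψ.toPreGNS.symm a).2)]
    simp
  add_left a b c := by
    rw [_root_.map_add, Submodule.coe_add, star_add, add_mul]
    exact ψ.ext_add (ψ.mul_mem_domain (ψ.toPreGNS.symm a).2 (ψ.toPreGNS.symm c).2)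
      (ψ.mul_mem_domain (ψ.toPreGNS.symm b).2 (ψ.toPreGNS.symm c).2)
  smul_left a b c := by
    rw [_root_.map_smul, Submodule.coe_smul, star_smul, smul_mul_assoc]
    exact ψ.ext_smul _ (ψ.mul_mem_domain (ψ.toPreGNS.symm a).2 (ψ.toPreGNS.symm b).2)

instance (ψ : Weight A) : SeminormedAddCommGroup ψ.PreGNS :=
  InnerProductSpace.Core.toSeminormedAddCommGroup (c := ψ.preGNSCore)

instance (ψ : Weight A) : InnerProductSpace ℂ ψ.PreGNS :=
  InnerProductSpace.ofCore ψ.preGNSCore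

theorem preGNS_inner (ψ : Weight A) (a b : ψ.PreGNS) :
    ⟪a, b⟫_ℂ = ψ.ext (star (ψ.toPreGNS.symm a : A) * ψ.toPreGNS.symm b) := rfl

theorem preGNS_norm_sq (ψ : Weight A) (a : ψ.PreGNS) :
    ‖a‖ ^ 2 = (ψ ⟨_, star_mul_self_nonneg (ψ.toPreGNS.symm a : A)⟩).toReal := by
  have h := inner_self_eq_norm_sq_to_K (𝕜 := ℂ) a
  rw [ψ.preGNS_inner, ψ.ext_pos (mem_N'.1 (ψ.toPreGNS.symm a).2)] at h
  apply Complex.ofReal_injective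
  rw [h]
  push_cast
  rfl

/-- Left multiplication by `a` on `𝒩_ψ`. -/
def leftMul (ψ : Weight A) (a : A) : ψ.PreGNS →L[ℂ] ψ.PreGNS :=
  LinearMap.mkContinuous
    { toFun := fun b => ψ.toPreGNS ⟨a * ψ.toPreGNS.symm b, ψ.mul_mem_N a (ψ.toPreGNS.symm b).2⟩
      map_add' := fun b c => by
        rw [← _root_.map_add]; congr 1; ext; simp [mul_add]
      map_smul' := fun r b => by
        rw [RingHom.id_apply, ← _root_.map_smul]; congr 1; ext; simp [mul_smul_comm] }
    ‖a‖ fun b => by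
      rw [← sq_le_sq₀ (by positivity) (by positivity), mul_pow, ψ.preGNS_norm_sq,
        ψ.preGNS_norm_sq]
      have hb := mem_N'.1 (ψ.toPreGNS.symm b).2
      have h := ψ.map_smul (‖a‖ ^ 2) (by positivity) ⟨_, hb.1⟩
      have h' := congrArg ENNReal.toReal h
      rw [ENNReal.toReal_mul, ENNReal.toReal_ofReal (by positivity)] at h'
      rw [← h']
      refine ENNReal.toReal_mono (ψ.finitePos_smul (by positivity) hb).2.ne (ψ.mono _ _ ?_)
      simp only [LinearMap.coe_mk, AddHom.coe_mk, LinearEquiv.symm_apply_apply]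
      rw [star_mul, mul_assoc, ← mul_assoc (star a), ← mul_assoc, sq,
        ← CStarRing.norm_star_mul_self (x := a)]
      exact CStarAlgebra.star_left_conjugate_le_norm_smul

theorem leftMul_apply (ψ : Weight A) (a : A) (b : ψ.N) :
    ψ.leftMul a (ψ.toPreGNS b) = ψ.toPreGNS ⟨a * b, ψ.mul_mem_N a b.2⟩ := rfl

theorem leftMul_add (ψ : Weight A) (a a' : A) :
    ψ.leftMul (a + a') = ψ.leftMul a + ψ.leftMul a' := by
  apply ContinuousLinearMap.ext
  intro b
  obtain ⟨b, rfl⟩ := ψ.toPreGNS.surjective b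
  rw [add_apply, leftMul_apply, leftMul_apply, leftMul_apply,
    ← _root_.map_add]
  congr 1; ext; simp [add_mul]

theorem leftMul_smul (ψ : Weight A) (c : ℂ) (a : A) :
    ψ.leftMul (c • a) = c • ψ.leftMul a := by
  apply ContinuousLinearMap.ext
  intro b
  obtain ⟨b, rfl⟩ := ψ.toPreGNS.surjective b
  rw [smul_apply, leftMul_apply, leftMul_apply, ← _root_.map_smul]
  congr 1; ext; simp [smul_mul_assoc]

theorem leftMul_mul (ψ : Weight A) (a a' : A) (b : ψ.PreGNS) :
    ψ.leftMul (a * a') b = ψ.leftMul a (ψ.leftMul a' b) := by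
  obtain ⟨b, rfl⟩ := ψ.toPreGNS.surjective b
  rw [leftMul_apply, leftMul_apply, leftMul_apply]
  congr 1; ext; simp [mul_assoc]

theorem leftMul_inner (ψ : Weight A) (a : A) (b c : ψ.PreGNS) :
    ⟪ψ.leftMul (star a) b, c⟫_ℂ = ⟪b, ψ.leftMul a c⟫_ℂ := by
  obtain ⟨b, rfl⟩ := ψ.toPreGNS.surjective b
  obtain ⟨c, rfl⟩ := ψ.toPreGNS.surjective c
  rw [leftMul_apply, leftMul_apply, preGNS_inner, preGNS_inner]
  simp [mul_assoc]

open UniformSpace in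
theorem completion_leftMul_smul (ψ : Weight A) (c : ℂ) (a : A) :
    (ψ.leftMul (c • a)).completion = c • (ψ.leftMul a).completion := by
  ext x
  induction x using Completion.induction_on with
  | hp =>
    exact isClosed_eq (ψ.leftMul (c • a)).completion.continuous
      (c • (ψ.leftMul a).completion).continuous
  | ih x => simp [leftMul_smul, Completion.coe_smul]

open UniformSpace in
/-- Left multiplication, as a representation of `A` on the completion of `𝒩_ψ`. -/
def gnsRep (ψ : Weight A) :
    A →⋆ₙₐ[ℂ] (Completion ψ.PreGNS →L[ℂ] Completion ψ.PreGNS) where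
  toFun a := (ψ.leftMul a).completion
  map_smul' c a := ψ.completion_leftMul_smul c a
  map_zero' := by simpa using ψ.completion_leftMul_smul 0 0
  map_add' a a' := by
    ext x
    induction x using Completion.induction_on with
    | hp => apply isClosed_eq <;> fun_prop
    | ih x => simp [leftMul_add, Completion.coe_add]
  map_mul' a a' := by
    ext x
    induction x using Completion.induction_on with
    | hp => apply isClosed_eq <;> fun_prop
    | ih x => simp [leftMul_mul]
  map_star' a := by
    refine (ContinuousLinearMap.eq_adjoint_iff _ _).mpr fun x y => ?_
    induction x, y using Completion.induction_on₂ with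
    | hp => apply isClosed_eq <;> fun_prop
    | ih x y => simp [leftMul_inner]

theorem exists_norm_sub_leftMul_lt {ψ : Weight A} (hψ : ψ.IsProper) (b : ψ.PreGNS) {ε : ℝ}
    (hε : 0 < ε) : ∃ e : A, ‖b - ψ.leftMul e b‖ ^ 2 < ε := by
  obtain ⟨b, rfl⟩ := ψ.toPreGNS.surjective b
  have hb := mem_N'.1 b.2
  have hU := CStarAlgebra.increasingApproximateUnit A
  have hconj : ∀ e : A, 0 ≤ e → ‖e‖ ≤ 1 → star (b : A) * e * b ≤ star (b : A) * b := by
    intro e he he1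
    have h1 : star (b : A) * e * b ≤ ‖e‖ • (star (b : A) * b) :=
      CStarAlgebra.star_left_conjugate_le_norm_smul
    exact h1.trans (by simpa using smul_le_smul_of_nonneg_right he1 hb.1)
  obtain ⟨e, he, he1, hlt⟩ : ∃ e : A, ∃ he : 0 ≤ e, ‖e‖ ≤ 1 ∧
      (ψ ⟨_, hb.1⟩).toReal - ε < (ψ ⟨_, star_left_conjugate_nonneg he (b : A)⟩).toReal := by
    by_contra! hcon
    have hr : 0 ≤ (ψ ⟨_, hb.1⟩).toReal - ε :=
      ENNReal.toReal_nonneg.trans (hcon 0 le_rfl (by simp))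
    have hcl := (hψ.closed _ hr)
    obtain ⟨s, hs, hs'⟩ := isClosed_induced_iff.1 hcl
    have hlim : Filter.Tendsto (fun e => star (b : A) * e * b) (CStarAlgebra.approximateUnit A)
        (𝓝 (star (b : A) * b)) := by
      simp only [mul_assoc]
      exact (hU.tendsto_mul_right (b : A)).const_mul _
    have hmem : star (b : A) * b ∈ s := by
      refine hs.mem_of_tendsto hlim ?_
      filter_upwards [hU.eventually_nonneg, hU.eventually_norm] with e he he1
      have h2 : (⟨_, star_left_conjugate_nonneg he (b : A)⟩ : {a : A // 0 ≤ a}) ∈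
          Subtype.val ⁻¹' s := by
        rw [hs']
        exact ENNReal.le_ofReal_iff_toReal_le (ψ.finitePos_of_le
          (star_left_conjugate_nonneg he (b : A)) (hconj e he he1) hb).2.ne hr |>.2
          (hcon e he he1)
      exact h2
    have h3 : (⟨_, hb.1⟩ : {a : A // 0 ≤ a}) ∈ Subtype.val ⁻¹' s := hmem
    rw [hs'] at h3
    have h4 := (ENNReal.le_ofReal_iff_toReal_le hb.2.ne hr).1 h3
    linarith
  refine ⟨e, ?_⟩
  have hee : e * e ≤ e := by
    obtain ⟨s, rfl⟩ := CStarAlgebra.nonneg_iff_eq_star_mul_self.1 he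
    have h1 : star s * (s * star s) * s ≤ ‖s * star s‖ • (star s * s) :=
      CStarAlgebra.star_left_conjugate_le_norm_smul
    rw [CStarRing.norm_self_mul_star, ← CStarRing.norm_star_mul_self] at h1
    have h2 := h1.trans (smul_le_smul_of_nonneg_right he1 he)
    simpa [mul_assoc] using h2
  have hsub : 0 ≤ star (b : A) * b - star (b : A) * e * b := sub_nonneg.2 (hconj e he he1)
  have hle : star ((b : A) - e * b) * (b - e * b) ≤ star (b : A) * b - star (b : A) * e * b := by
    have h1 := star_left_conjugate_le_conjugate hee (b : A)
    have h2 : star ((b : A) - e * b) * (b - e * b)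
        = star (b : A) * b - star (b : A) * e * b
          - (star (b : A) * e * b - star (b : A) * (e * e) * b) := by
      rw [star_sub, star_mul, (IsSelfAdjoint.of_nonneg he).star_eq]
      noncomm_ring
    rw [h2]
    exact sub_le_self _ (sub_nonneg.2 h1)
  have hfin := ψ.finitePos_of_le hsub
    (sub_le_self _ (star_left_conjugate_nonneg he (b : A))) hb
  have hfin' := ψ.finitePos_of_le (star_left_conjugate_nonneg he (b : A)) (hconj e he he1) hb
  have hadd : (ψ ⟨_, hb.1⟩).toReal = (ψ ⟨_, hsub⟩).toReal + (ψ ⟨_, hfin'.1⟩).toReal := by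
    rw [← ψ.toReal_add hfin.2 hfin'.2]
    congr 2
    ext
    simp
  have e1 : ψ.toPreGNS b - ψ.leftMul e (ψ.toPreGNS b)
      = ψ.toPreGNS (b - ⟨e * b, ψ.mul_mem_N e b.2⟩) := by
    rw [leftMul_apply, ← _root_.map_sub]
  rw [e1, preGNS_norm_sq]
  refine lt_of_le_of_lt (ENNReal.toReal_mono hfin.2.ne (ψ.mono _ hsub ?_)) (by linarith)
  simpa using hle

open UniformSpace in
/-- The GNS construction of a proper weight, on the completion of `𝒩_ψ`. -/
def gns (ψ : Weight A) (hψ : ψ.IsProper) : ψ.GNS (Completion ψ.PreGNS) where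
  Λ := (Completion.toComplₗᵢ (𝕜 := ℂ) (E := ψ.PreGNS)).toLinearMap ∘ₗ ψ.toPreGNS.toLinearMap
  π := ψ.gnsRep
  denseRange := Completion.denseRange_coe.comp ψ.toPreGNS.surjective.denseRange
    (Completion.continuous_coe _)
  nondegenerate := by
    rw [← dense_closure]
    refine Completion.denseRange_coe.mono ?_
    rintro _ ⟨b, rfl⟩
    rw [Metric.mem_closure_iff]
    intro ε hε
    obtain ⟨e, he⟩ := exists_norm_sub_leftMul_lt hψ b (sq_pos_of_pos hε)
    refine ⟨_, Submodule.subset_span ⟨e, (b : Completion ψ.PreGNS), rfl⟩, ?_⟩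
    have h1 : ψ.gnsRep e (b : Completion ψ.PreGNS) = (ψ.leftMul e b : Completion ψ.PreGNS) :=
      ContinuousLinearMap.completion_apply_coe _ _
    rw [h1, Completion.dist_eq, dist_eq_norm]
    exact lt_of_pow_lt_pow_left₀ 2 hε.le he
  inner_Λ a b := Completion.inner_coe (𝕜 := ℂ) (ψ.toPreGNS b) (ψ.toPreGNS a)
  π_Λ a b := ContinuousLinearMap.completion_apply_coe (ψ.leftMul a) (ψ.toPreGNS b)

end Weight

/-- A GNS triple `(π, H, ξ)` of a functional `φ` on a ⋆-algebra `B`. -/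
structure StateGNS {B : Type*} [NonUnitalRing B] [StarRing B] [Module ℂ B] (φ : B → ℂ)
    (H : Type*) [NormedAddCommGroup H] [InnerProductSpace ℂ H] [CompleteSpace H] where
  π : B →⋆ₙₐ[ℂ] (H →L[ℂ] H)
  ξ : H
  cyclic : DenseRange fun b => π b ξ
  inner_ξ : ∀ b, ⟪ξ, π b ξ⟫_ℂ = φ b

namespace StateGNS

variable {B : Type*} [NonUnitalRing B] [StarRing B] [Module ℂ B] {φ : B → ℂ}
  {H : Type*} [NormedAddCommGroup H] [InnerProductSpace ℂ H] [CompleteSpace H]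

/-- The map `b ↦ π(b)ξ`. -/
def orbit (G : StateGNS φ H) : B →ₗ[ℂ] H where
  toFun b := G.π b G.ξ
  map_add' a b := by simp
  map_smul' c a := by simp

theorem norm_orbit (G : StateGNS φ H) {σ : B ≃⋆ₐ[ℂ] B} (hσ : ∀ b, φ (σ b) = φ b) (b : B) :
    ‖G.orbit (σ b)‖ = ‖G.orbit b‖ := by
  have key : ∀ b, ((‖G.orbit b‖ : ℂ)) ^ 2 = φ (star b * b) := by
    intro b
    have h := inner_self_eq_norm_sq_to_K (𝕜 := ℂ) (G.orbit b)
    rw [← G.inner_ξ, map_mul, map_star, ContinuousLinearMap.star_eq_adjoint,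
      mul_apply_eq_comp, ContinuousLinearMap.adjoint_inner_right]
    exact h.symm
  rw [← sq_eq_sq₀ (norm_nonneg _) (norm_nonneg _)]
  apply Complex.ofReal_injective
  push_cast
  rw [key, key, ← hσ (star b * b), map_mul, map_star]

/-- An automorphism, as a linear equivalence. -/
def linearEquivOfAut (σ : B ≃⋆ₐ[ℂ] B) : B ≃ₗ[ℂ] B where
  toFun := σ
  invFun := σ.symm
  left_inv := σ.symm_apply_apply
  right_inv := σ.apply_symm_apply
  map_add' := map_add σ
  map_smul' := map_smul σ

/-- The unitary `U` with `U π(b)ξ = π(σ(b))ξ`, for an automorphism `σ` that preserves `φ`. -/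
def unitary (G : StateGNS φ H) {σ : B ≃⋆ₐ[ℂ] B} (hσ : ∀ b, φ (σ b) = φ b) : H ≃ₗᵢ[ℂ] H :=
  (linearEquivOfAut σ).extendOfIsometry G.orbit G.orbit G.cyclic G.cyclic
    (G.norm_orbit hσ)

theorem unitary_orbit (G : StateGNS φ H) {σ : B ≃⋆ₐ[ℂ] B} (hσ : ∀ b, φ (σ b) = φ b) (b : B) :
    G.unitary hσ (G.orbit b) = G.orbit (σ b) :=
  LinearEquiv.extendOfIsometry_eq ..

theorem unitary_conj (G : StateGNS φ H) {σ : B ≃⋆ₐ[ℂ] B} (hσ : ∀ b, φ (σ b) = φ b) (b : B) :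
    (G.unitary hσ).conjStarAlgEquiv (G.π b) = G.π (σ b) := by
  have key : ∀ η, G.unitary hσ (G.π b η) = G.π (σ b) (G.unitary hσ η) := by
    refine fun η => G.cyclic.induction ?_ (isClosed_eq (by fun_prop) (by fun_prop)) η
    rintro _ ⟨c, rfl⟩
    change G.unitary hσ (G.π b (G.π c G.ξ)) = G.π (σ b) (G.unitary hσ (G.π c G.ξ))
    have e1 : G.π b (G.π c G.ξ) = G.orbit (b * c) := by simp [orbit]
    have e2 : G.π c G.ξ = G.orbit c := rfl
    rw [e1, e2, G.unitary_orbit, G.unitary_orbit]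
    simp [orbit]
  ext η
  rw [LinearIsometryEquiv.conjStarAlgEquiv_apply_apply, key, LinearIsometryEquiv.apply_symm_apply]

/-- The modular group `θ'_t = Ad U_{-βt}` on `π_φ(B)''`, where `U_s π_φ(b)ξ_φ = π_φ(α_s(b))ξ_φ`; thus
`θ'_t(π_φ(b)) = π_φ(α_{-βt}(b))`. -/
def modularGroup [TopologicalSpace B] (G : StateGNS φ H) (α : OneParamGroup B)
    (hφ : ∀ t b, φ (α t b) = φ b) (β t : ℝ) : bicommutant G.π ≃⋆ₐ[ℂ] bicommutant G.π :=
  adBicommutant G.π (α (-β * t)) (G.unitary (hφ (-β * t))) (G.unitary_conj (hφ (-β * t)))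

end StateGNS

namespace Weight

variable {A : Type*} [NonUnitalCStarAlgebra A] [PartialOrder A] [StarOrderedRing A]

/-- The normalized restriction `φ(x) = ψ(p)⁻¹ ψ(x)` of `ψ` to `pAp`. -/
def cornerState (ψ : Weight A) (p : A) (hp : IsStarProjection p) (x : corner p hp) : ℂ :=
  (ψ.ext p)⁻¹ * ψ.ext x

theorem IsKMS.cornerState_invariant {ψ : Weight A} {α : OneParamGroup A} {β : ℝ}
    (hψ : ψ.IsKMS α β) {p : A} {hp : IsStarProjection p} (hαp : ∀ t, α t p = p) (t : ℝ)
    (x : corner p hp) :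
    ψ.cornerState p hp (α.restrictCorner p hp hαp t x) = ψ.cornerState p hp x := by
  unfold cornerState
  congr 1
  exact (hψ.invariant t).ext_apply x

end Weight

end KMSCorner
end

open KMSCorner

open scoped ENNReal InnerProductSpace Topology

noncomputable section

namespace KMSCorner

/-! Write Λ, π, H for the GNS data of ψ and ρ for the GNS representation of pAp. First, an invariant
projection p has finite weight (`Weight.IsKMS.proj_mem_Nsym`), so ρ(x)ξ ↦ ψ(p)^(-1/2) Λ(x) defines
an isometry V of the state space into H, with π(p)π(a)V = Vρ(pap) (`exists_cornerIntertwiner`). Its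
range is the closure of Λ(pAp), whereas π(p)H is the closure of Λ(p𝒩_ψ); V need not be onto π(p)H,
so conjugation by V is not enough.

The isomorphism is the inverse of the compression x ↦ V⋆xV from the corner of π(A)'' to ρ(pAp)''.
Everything rests on one extension principle, `exists_extension`: an operator commuting with all
V⋆s⋆tV extends from sV to the subspace generated by a ⋆-closed multiplicative family S. With S =
π(A) it lifts operators of ρ(pAp)' to π(A)', so that compressions land in ρ(pAp)'' and corner
elements preserve the range of V. With S = π(A)' it lifts operators of ρ(pAp)'' to the corner of
π(A)'', which is surjectivity.

Injectivity is where the KMS condition and fullness enter. It suffices that π(A)'VK is total in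
π(p)H, where K is the space of ρ. On analytic elements the KMS condition makes right multiplication
bounded (`Weight.GNS.IsSymEntire.norm_vec_mul_le`), so right multiplication by b is given by an
operator R_b in π(A)', and π(p)Λ(b) = Λ(pb) = R_bΛ(p). Gaussian smoothing along α makes such Λ(b)
dense. Fullness gives Λ(p) ≠ 0, so Λ(p) lies in the range of V.

Equivariance is the relation VU'_s = U_sV, checked on the vectors ρ(x)ξ. -/

/-! ### Extending operators along a family that generates a subspace -/

section Extension

open ContinuousLinearMap

variable {H K : Type*} [NormedAddCommGroup H] [InnerProductSpace ℂ H]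
  [NormedAddCommGroup K] [InnerProductSpace ℂ K]

/-- The closed linear span of the vectors `s V k` with `s ∈ S`. -/
def generatedSubspace (S : Set (H →L[ℂ] H)) (V : K →L[ℂ] H) : Submodule ℂ H :=
  (Submodule.span ℂ {η | ∃ s ∈ S, ∃ k, η = s (V k)}).topologicalClosure

theorem apply_mem_generatedSubspace {S : Set (H →L[ℂ] H)} (V : K →L[ℂ] H) {s : H →L[ℂ] H}
    (hs : s ∈ S) (k : K) : s (V k) ∈ generatedSubspace S V :=
  Submodule.le_topologicalClosure _ (Submodule.subset_span ⟨s, hs, k, rfl⟩)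

theorem generatedSubspace_le {S : Set (H →L[ℂ] H)} {V : K →L[ℂ] H} {P : Submodule ℂ H}
    (hP : IsClosed (P : Set H)) (h : ∀ s ∈ S, ∀ k, s (V k) ∈ P) : generatedSubspace S V ≤ P := by
  refine Submodule.topologicalClosure_minimal _ (Submodule.span_le.2 ?_) hP
  rintro _ ⟨s, hs, k, rfl⟩
  exact h s hs k

theorem mem_generatedSubspace_orthogonal {S : Set (H →L[ℂ] H)} {V : K →L[ℂ] H} {η : H} :
    η ∈ (generatedSubspace S V)ᗮ ↔ ∀ s ∈ S, ∀ k, ⟪s (V k), η⟫_ℂ = 0 := by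
  rw [generatedSubspace, Submodule.orthogonal_closure]
  constructor
  · exact fun h s hs k => h _ (Submodule.subset_span ⟨s, hs, k, rfl⟩)
  · intro h u hu
    induction hu using Submodule.span_induction with
    | mem u hu => obtain ⟨s, hs, k, rfl⟩ := hu; exact h s hs k
    | zero => simp
    | add u v _ _ hu hv => rw [inner_add_left, hu, hv, add_zero]
    | smul c u _ hu => rw [inner_smul_left, hu, mul_zero]

/-- The map `(k_s)_s ↦ ∑ s V T k_s` on finitely supported families. -/
def generator (S : Set (H →L[ℂ] H)) (V : K →L[ℂ] H) (T : K →L[ℂ] K) : (S →₀ K) →ₗ[ℂ] H :=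
  Finsupp.lsum ℂ fun s => ((s : H →L[ℂ] H) ∘L V ∘L T).toLinearMap

theorem generator_single (S : Set (H →L[ℂ] H)) (V : K →L[ℂ] H) (T : K →L[ℂ] K) (s : S) (k : K) :
    generator S V T (Finsupp.single s k) = (s : H →L[ℂ] H) (V (T k)) := by
  simp [generator]

theorem generator_add (S : Set (H →L[ℂ] H)) (V : K →L[ℂ] H) (T T' : K →L[ℂ] K) :
    generator S V (T + T') = generator S V T + generator S V T' := by
  ext s k
  simp [generator_single]

theorem generator_smul (S : Set (H →L[ℂ] H)) (V : K →L[ℂ] H) (c : ℂ) (T : K →L[ℂ] K) :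
    generator S V (c • T) = c • generator S V T := by
  ext s k
  simp [generator_single]

variable [CompleteSpace H] [CompleteSpace K]

/-- On single vectors this moves T⋆ past the Gram operator V⋆s⋆tV. It commutes with T⋆ because its
adjoint V⋆t⋆sV, which belongs to the same family, commutes with T. -/
theorem inner_generator (S : Set (H →L[ℂ] H)) (V : K →L[ℂ] H) {T : K →L[ℂ] K}
    (hT : ∀ s ∈ S, ∀ t ∈ S, Commute (adjoint V ∘L adjoint s ∘L t ∘L V) T)
    (T' : K →L[ℂ] K) (f g : S →₀ K) :
    ⟪generator S V T f, generator S V T' g⟫_ℂ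
      = ⟪generator S V 1 f, generator S V (adjoint T * T') g⟫_ℂ := by
  induction f using Finsupp.induction_linear with
  | zero => simp
  | add f f' hf hf' => rw [map_add, map_add, inner_add_left, inner_add_left, hf, hf']
  | single s k =>
    induction g using Finsupp.induction_linear with
    | zero => simp
    | add g g' hg hg' => rw [map_add, map_add, inner_add_right, inner_add_right, hg, hg']
    | single t k' =>
      have h := (hT t t.2 s s.2).star_star.eq
      simp only [star_eq_adjoint, adjoint_comp, adjoint_adjoint] at h
      have h' := congrArg (fun X : K →L[ℂ] K => ⟪k, X (T' k')⟫_ℂ) h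
      simp only [generator_single, one_apply_eq_self, mul_apply_eq_comp, comp_apply,
        adjoint_inner_right] at h' ⊢
      exact h'.symm

/-- The defect Q = ‖T‖² - T⋆T is positive, and Q and its square root commute with the Gram operators
along with T. Hence ‖T‖²‖∑ sVk_s‖² - ‖∑ sVTk_s‖² is the squared norm of ∑ sV√Q k_s, and is
non-negative. -/
theorem norm_generator_le (S : Set (H →L[ℂ] H)) (V : K →L[ℂ] H) {T : K →L[ℂ] K}
    (hT : ∀ s ∈ S, ∀ t ∈ S, Commute (adjoint V ∘L adjoint s ∘L t ∘L V) T) (f : S →₀ K) :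
    ‖generator S V T f‖ ≤ ‖T‖ * ‖generator S V 1 f‖ := by
  set Q : K →L[ℂ] K := algebraMap ℝ (K →L[ℂ] K) (‖T‖ ^ 2) - star T * T with hQ
  have hQ0 : 0 ≤ Q := sub_nonneg.2 CStarAlgebra.star_mul_le_algebraMap_norm_sq
  have hTQ : ∀ s ∈ S, ∀ t ∈ S, Commute (adjoint V ∘L adjoint s ∘L t ∘L V) Q := by
    intro s hs t ht
    have h := (hT t ht s hs).star_star
    simp only [star_eq_adjoint, adjoint_comp, adjoint_adjoint] at h
    exact (Algebra.commute_algebraMap_right _ _).sub_right (h.mul_right (hT s hs t ht))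
  have hR : ∀ s ∈ S, ∀ t ∈ S, Commute (adjoint V ∘L adjoint s ∘L t ∘L V) (CFC.sqrt Q) :=
    fun s hs t ht => ((hTQ s hs t ht).symm.cfcₙ_nnreal _).symm
  have e1 := inner_generator S V hT T f f
  have e2 := inner_generator S V hR (CFC.sqrt Q) f f
  have e3 : adjoint (CFC.sqrt Q) * CFC.sqrt Q =
      ((‖T‖ ^ 2 : ℝ) : ℂ) • 1 + (-1 : ℂ) • (adjoint T * T) := by
    rw [← star_eq_adjoint, (IsSelfAdjoint.of_nonneg (CFC.sqrt_nonneg Q)).star_eq,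
      CFC.sqrt_mul_sqrt_self Q, hQ, Algebra.algebraMap_eq_smul_one, Complex.coe_smul,
      star_eq_adjoint, neg_one_smul, sub_eq_add_neg]
  rw [e3, generator_add, generator_smul, generator_smul, LinearMap.add_apply, LinearMap.smul_apply,
    LinearMap.smul_apply, inner_add_right, inner_smul_right, inner_smul_right, ← e1,
    inner_self_eq_norm_sq_to_K, inner_self_eq_norm_sq_to_K, inner_self_eq_norm_sq_to_K] at e2
  have e4 : ‖generator S V (CFC.sqrt Q) f‖ ^ 2
      = ‖T‖ ^ 2 * ‖generator S V 1 f‖ ^ 2 - ‖generator S V T f‖ ^ 2 := by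
    apply Complex.ofReal_injective
    push_cast
    simp only [Complex.coe_algebraMap] at e2
    rw [e2]
    push_cast
    ring
  refine le_of_sq_le_sq ?_ (by positivity)
  nlinarith [sq_nonneg ‖generator S V (CFC.sqrt Q) f‖]

/-- An operator `T` that commutes with the operators `V⋆ s⋆ t V`, where `s, t ∈ S`, extends to an
operator `X` with `X s V = s V T` for `s ∈ S`. -/
theorem exists_extension (S : Set (H →L[ℂ] H)) (hmul : ∀ s ∈ S, ∀ t ∈ S, s * t ∈ S)
    (hstar : ∀ s ∈ S, star s ∈ S) (V : K →L[ℂ] H) {T : K →L[ℂ] K}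
    (hT : ∀ s ∈ S, ∀ t ∈ S, Commute (adjoint V ∘L adjoint s ∘L t ∘L V) T) :
    ∃ X : H →L[ℂ] H, (∀ s ∈ S, ∀ k, X (s (V k)) = s (V (T k))) ∧ (∀ s ∈ S, s * X = X * s) ∧
      (∀ η, X η ∈ generatedSubspace S V) ∧ ∀ η ∈ (generatedSubspace S V)ᗮ, X η = 0 := by
  set P := generatedSubspace S V with hP
  have : CompleteSpace P := (Submodule.isClosed_topologicalClosure _).completeSpace_coe
  have hgen : ∀ T f, generator S V T f ∈ P := by
    intro T f
    induction f using Finsupp.induction_linear with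
    | zero => simp
    | add f g hf hg => rw [map_add]; exact P.add_mem hf hg
    | single s k => rw [generator_single]; exact apply_mem_generatedSubspace V s.2 _
  let L : (S →₀ K) →ₗ[ℂ] P := (generator S V 1).codRestrict P (hgen 1)
  have hL : DenseRange L := by
    rw [DenseRange, Subtype.dense_iff]
    intro x hx
    have hle : Submodule.span ℂ {η | ∃ s ∈ S, ∃ k, η = s (V k)} ≤
        LinearMap.range (generator S V 1) := by
      rw [Submodule.span_le]
      rintro _ ⟨s, hs, k, rfl⟩
      exact ⟨Finsupp.single ⟨s, hs⟩ k, by simp [generator_single]⟩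
    have : x ∈ closure (LinearMap.range (generator S V 1) : Set H) :=
      closure_mono hle hx
    convert this using 2
    ext y
    constructor
    · rintro ⟨_, ⟨f, rfl⟩, rfl⟩
      exact ⟨f, rfl⟩
    · rintro ⟨f, rfl⟩
      exact ⟨_, ⟨f, rfl⟩, rfl⟩
  have hbd : ∃ C, ∀ f, ‖generator S V T f‖ ≤ C * ‖L f‖ := ⟨‖T‖, norm_generator_le S V hT⟩
  let E : P →L[ℂ] H := (generator S V T).extendOfNorm L
  have hE : ∀ f, E (L f) = generator S V T f := LinearMap.extendOfNorm_eq hL hbd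
  -- Extension by zero on Pᗮ is a choice, and it is this choice that lets X commute with S on all of
  -- H.
  let X : H →L[ℂ] H := E ∘L P.orthogonalProjectionOnto
  have hX0 : ∀ η ∈ Pᗮ, X η = 0 := fun η hη => by
    simp [X, (Submodule.orthogonalProjectionOnto_eq_zero_iff).2 hη]
  have hXs : ∀ s ∈ S, ∀ k, X (s (V k)) = s (V (T k)) := by
    intro s hs k
    have h1 := hE (Finsupp.single ⟨s, hs⟩ k)
    rw [generator_single] at h1
    have h2 : P.orthogonalProjectionOnto (s (V k)) = L (Finsupp.single ⟨s, hs⟩ k) := by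
      have h3 := P.orthogonalProjectionOnto_mem_subspace_eq_self
        (⟨s (V k), apply_mem_generatedSubspace V hs k⟩ : P)
      rw [h3]
      apply Subtype.ext
      simp [L, generator_single]
    simp only [X, comp_apply]
    rw [h2, h1]
  refine ⟨X, hXs, ?_, ?_, hX0⟩
  · intro s hs
    have hon : ∀ η ∈ P, (s * X) η = (X * s) η := by
      refine fun η hη => generatedSubspace_le
        (P := LinearMap.eqLocus (s * X).toLinearMap (X * s).toLinearMap)
        (isClosed_eq (s * X).continuous (X * s).continuous) ?_ hη
      intro t ht k
      change s (X (t (V k))) = X (s (t (V k)))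
      rw [hXs t ht, ← mul_apply_eq_comp s t, ← mul_apply_eq_comp s t, hXs _ (hmul s hs t ht)]
    ext η
    obtain ⟨y, hy, z, hz, rfl⟩ := P.exists_add_mem_mem_orthogonal η
    rw [map_add, map_add, hon y hy]
    congr 1
    -- P is invariant under s⋆, which again lies in S, so Pᗮ is invariant under s.
    have hsz : s z ∈ Pᗮ := by
      rw [hP, mem_generatedSubspace_orthogonal] at hz ⊢
      intro t ht k
      have := hz _ (hmul _ (hstar s hs) t ht) k
      rwa [mul_apply_eq_comp, star_eq_adjoint, adjoint_inner_left] at this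
    simp [hX0 z hz, hX0 _ hsz]
  · intro η
    refine hL.induction_on (p := fun ζ => E ζ ∈ P) (P.orthogonalProjectionOnto η)
      ((Submodule.isClosed_topologicalClosure _).preimage E.continuous) ?_
    intro f
    rw [hE]
    exact hgen T f

end Extension

/-! ### Compressing the corner of a bicommutant to a generating subspace -/

section Compression

open ContinuousLinearMap

variable {A : Type*} [NonUnitalRing A] [StarRing A] [Module ℂ A]
  {H K : Type*} [NormedAddCommGroup H] [InnerProductSpace ℂ H] [CompleteSpace H]
  [NormedAddCommGroup K] [InnerProductSpace ℂ K] [CompleteSpace K]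

theorem mem_commutant {π : A →⋆ₙₐ[ℂ] (H →L[ℂ] H)} {x : H →L[ℂ] H} :
    x ∈ StarSubalgebra.centralizer ℂ (Set.range π) ↔ ∀ a, π a * x = x * π a := by
  rw [StarSubalgebra.mem_centralizer_iff]
  constructor
  · exact fun h a => (h _ ⟨a, rfl⟩).1
  · rintro h _ ⟨a, rfl⟩
    exact ⟨h a, by rw [← map_star]; exact h _⟩

theorem mem_bicommutant_iff {π : A →⋆ₙₐ[ℂ] (H →L[ℂ] H)} {x : H →L[ℂ] H} :
    x ∈ bicommutant π ↔ ∀ s ∈ StarSubalgebra.centralizer ℂ (Set.range π), s * x = x * s := by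
  rw [bicommutant, StarSubalgebra.mem_centralizer_iff]
  exact ⟨fun h s hs => (h s hs).1, fun h s hs => ⟨h s hs, h _ (star_mem hs)⟩⟩

variable {p : A} {hp : IsStarProjection p} {π : A →⋆ₙₐ[ℂ] (H →L[ℂ] H)}
  (x : corner (⟨π p, mem_bicommutant π p⟩ : bicommutant π) (isStarProjection_bicommutant π hp))

theorem proj_corner (η : H) : π p (((x : bicommutant π) : H →L[ℂ] H) η)
    = ((x : bicommutant π) : H →L[ℂ] H) η := by
  obtain ⟨_, y, rfl⟩ := x
  change (π p * (π p * (y : H →L[ℂ] H) * π p)) η = (π p * (y : H →L[ℂ] H) * π p) η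
  rw [← mul_assoc, ← mul_assoc, ← map_mul, hp.isIdempotentElem.eq]

theorem corner_proj (η : H) : ((x : bicommutant π) : H →L[ℂ] H) (π p η)
    = ((x : bicommutant π) : H →L[ℂ] H) η := by
  obtain ⟨_, y, rfl⟩ := x
  change (π p * (y : H →L[ℂ] H) * π p * π p) η = (π p * (y : H →L[ℂ] H) * π p) η
  rw [mul_assoc, ← map_mul, hp.isIdempotentElem.eq]

variable [IsScalarTower ℂ A A] [SMulCommClass ℂ A A]

/-- An isometry `V` from the space of a representation `ρ` of `pAp` into the space of a
representation `π` of `A` that intertwines the compressions: `π(p) π(a) V = V ρ(pap)`. -/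
structure IsCornerIntertwiner (p : A) (hp : IsStarProjection p) (π : A →⋆ₙₐ[ℂ] (H →L[ℂ] H))
    (ρ : corner p hp →⋆ₙₐ[ℂ] (K →L[ℂ] K)) (V : K →L[ℂ] H) : Prop where
  isometry : adjoint V ∘L V = 1
  apply_proj : ∀ k, π p (V k) = V k
  compress : ∀ a k, π p (π a (V k)) = V (ρ ⟨p * a * p, a, rfl⟩ k)

namespace IsCornerIntertwiner

variable {ρ : corner p hp →⋆ₙₐ[ℂ] (K →L[ℂ] K)} {V : K →L[ℂ] H}

theorem adjoint_apply_apply (hV : IsCornerIntertwiner p hp π ρ V) (k : K) :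
    adjoint V (V k) = k := DFunLike.congr_fun hV.isometry k

theorem apply_apply (hV : IsCornerIntertwiner p hp π ρ V) (x : corner p hp) (k : K) :
    π x (V k) = V (ρ x k) := by
  obtain ⟨_, a, rfl⟩ := x
  rw [← hV.compress, map_mul, map_mul, mul_apply_eq_comp, mul_apply_eq_comp, hV.apply_proj]

theorem adjoint_proj (hV : IsCornerIntertwiner p hp π ρ V) (η : H) :
    adjoint V (π p η) = adjoint V η := by
  refine ext_inner_left ℂ fun k => ?_
  rw [adjoint_inner_right, adjoint_inner_right, ← adjoint_inner_left, ← star_eq_adjoint,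
    ← map_star, hp.isSelfAdjoint.star_eq, hV.apply_proj]

theorem adjoint_apply (hV : IsCornerIntertwiner p hp π ρ V) (x : corner p hp) (η : H) :
    adjoint V (π x η) = ρ x (adjoint V η) := by
  refine ext_inner_left ℂ fun k => ?_
  rw [adjoint_inner_right, ← adjoint_inner_left, ← star_eq_adjoint, ← map_star,
    ← adjoint_inner_left (ρ x), adjoint_inner_right, ← star_eq_adjoint, ← map_star]
  exact congrArg (fun y => ⟪y, η⟫_ℂ) (hV.apply_apply (star x) k)

/-- Since V⋆ = V⋆π(p), the Gram operator V⋆π(a)⋆π(b)V equals ρ(p a⋆b p), an element of ρ(pAp). -/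
theorem commute_compress (hV : IsCornerIntertwiner p hp π ρ V) {T : K →L[ℂ] K}
    (hT : T ∈ StarSubalgebra.centralizer ℂ (Set.range ρ)) :
    ∀ s ∈ Set.range π, ∀ t ∈ Set.range π, Commute (adjoint V ∘L adjoint s ∘L t ∘L V) T := by
  rintro _ ⟨a, rfl⟩ _ ⟨b, rfl⟩
  have h : adjoint V ∘L adjoint (π a) ∘L π b ∘L V = ρ ⟨p * (star a * b) * p, _, rfl⟩ := by
    ext k
    rw [← star_eq_adjoint, ← map_star]
    simp only [comp_apply]
    rw [← mul_apply_eq_comp (π (star a)), ← map_mul, ← hV.adjoint_proj, hV.compress,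
      hV.adjoint_apply_apply]
  rw [h]
  exact mem_commutant.1 hT _

/-- The extension principle for the family π(A). The range of X lies in the closed span of π(A)VK,
which π(p) maps into the range of V because π(p)π(a)V = Vρ(pap). -/
theorem exists_extension_of_mem_commutant (hV : IsCornerIntertwiner p hp π ρ V) {T : K →L[ℂ] K}
    (hT : T ∈ StarSubalgebra.centralizer ℂ (Set.range ρ)) :
    ∃ X ∈ StarSubalgebra.centralizer ℂ (Set.range π), (∀ k, X (V k) = V (T k)) ∧
      ∀ η, ∃ k, π p (X η) = V k := by
  obtain ⟨X, hX, hcomm, hrange, -⟩ := exists_extension (Set.range π)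
    (by rintro _ ⟨a, rfl⟩ _ ⟨b, rfl⟩; exact ⟨a * b, map_mul π a b⟩)
    (by rintro _ ⟨a, rfl⟩; exact ⟨star a, map_star π a⟩) V (hV.commute_compress hT)
  refine ⟨X, mem_commutant.2 fun a => hcomm _ ⟨a, rfl⟩, fun k => ?_, fun η => ?_⟩
  -- A may lack a unit, so V k is rewritten as π(p) V k to become one of the vectors on which X is
  -- prescribed.
  · rw [← hV.apply_proj k, hX _ ⟨p, rfl⟩, hV.apply_proj]
  -- Lying in the range of V is phrased as the closed linear equation VV⋆π(p)η = π(p)η, so that it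
  -- passes to the closed span.
  · have hcl : IsClosed (LinearMap.eqLocus ((V ∘L adjoint V ∘L π p).toLinearMap)
        (π p).toLinearMap : Set H) :=
      isClosed_eq (V ∘L adjoint V ∘L π p).continuous (π p).continuous
    have h := generatedSubspace_le (S := Set.range π) (V := V) hcl (by
      rintro _ ⟨a, rfl⟩ k
      change V (adjoint V (π p (π a (V k)))) = π p (π a (V k))
      rw [hV.compress, hV.adjoint_apply_apply]) (hrange η)
    exact ⟨_, h.symm⟩

/-- Corner elements preserve the range of V. Lifting the identity gives X in π(A)' with XV = V and
π(p)XH inside the range of V. Since x commutes with X, xVk = xXVk = XxVk; applying π(p), which fixes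
the range of x, puts xVk in the range of V. -/
theorem corner_apply (hV : IsCornerIntertwiner p hp π ρ V) (k : K) :
    V (adjoint V (((x : bicommutant π) : H →L[ℂ] H) (V k)))
      = ((x : bicommutant π) : H →L[ℂ] H) (V k) := by
  obtain ⟨X, hX, hXV, hrange⟩ := hV.exists_extension_of_mem_commutant (one_mem _)
  have h := DFunLike.congr_fun (mem_bicommutant_iff.1 (x : bicommutant π).2 X hX) (V k)
  simp only [mul_apply_eq_comp, hXV, one_apply_eq_self] at h
  obtain ⟨k', hk'⟩ := hrange (((x : bicommutant π) : H →L[ℂ] H) (V k))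
  rw [h, proj_corner (hp := hp)] at hk'
  rw [hk', hV.adjoint_apply_apply]

/-- Let T in ρ(pAp)' lift to X in π(A)', with XV = VT. Then x commutes with X and xV = VV⋆xV, which
together let T pass through V⋆xV. -/
theorem compress_mem_bicommutant (hV : IsCornerIntertwiner p hp π ρ V) :
    adjoint V ∘L ((x : bicommutant π) : H →L[ℂ] H) ∘L V ∈ bicommutant ρ := by
  rw [mem_bicommutant_iff]
  intro T hT
  obtain ⟨X, hX, hXV, -⟩ := hV.exists_extension_of_mem_commutant hT
  ext k
  have h := DFunLike.congr_fun (mem_bicommutant_iff.1 (x : bicommutant π).2 X hX) (V k)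
  simp only [mul_apply_eq_comp, hXV, comp_apply] at h ⊢
  rw [← h, ← corner_apply x hV k, hXV, hV.adjoint_apply_apply, hV.adjoint_apply_apply]

/-- The compression `x ↦ V⋆ x V` of the corner of `π(A)''` to the space of `ρ`. -/
def compression (hV : IsCornerIntertwiner p hp π ρ V) :
    corner (⟨π p, mem_bicommutant π p⟩ : bicommutant π) (isStarProjection_bicommutant π hp)
      →⋆ₙₐ[ℂ] bicommutant ρ where
  toFun x := ⟨adjoint V ∘L ((x : bicommutant π) : H →L[ℂ] H) ∘L V, hV.compress_mem_bicommutant x⟩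
  map_smul' c x := by ext k; simp
  map_zero' := by ext k; simp
  map_add' x y := by ext k; simp
  map_mul' x y := by
    ext k
    simp [hV.corner_apply y k]
  map_star' x := by
    apply Subtype.ext
    simp [star_eq_adjoint, comp_assoc]

theorem coe_compression (hV : IsCornerIntertwiner p hp π ρ V) :
    (hV.compression x : K →L[ℂ] K) = adjoint V ∘L ((x : bicommutant π) : H →L[ℂ] H) ∘L V := rfl

/-- If V⋆xV = 0 then xV = 0, because x preserves the range of V. As x commutes with π(A)', it
vanishes on the subspace generated by π(A)'VK; this contains π(p)H, and x = xπ(p). -/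
theorem compression_injective (hV : IsCornerIntertwiner p hp π ρ V)
    (hgen : ∀ η, π p η ∈ generatedSubspace
      (StarSubalgebra.centralizer ℂ (Set.range π) : Set (H →L[ℂ] H)) V) :
    Function.Injective hV.compression := by
  rw [injective_iff_map_eq_zero]
  intro x hx
  apply Subtype.ext
  apply Subtype.ext
  have hVx : ∀ k, ((x : bicommutant π) : H →L[ℂ] H) (V k) = 0 := by
    intro k
    rw [← hV.corner_apply x k]
    have := congrArg (fun y : bicommutant ρ => V ((y : K →L[ℂ] K) k)) hx
    simpa [compression] using this
  ext η
  have h := generatedSubspace_le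
    (S := (StarSubalgebra.centralizer ℂ (Set.range π) : Set (H →L[ℂ] H)))
    (V := V) (P := LinearMap.ker ((x : bicommutant π) : H →L[ℂ] H).toLinearMap)
    (((x : bicommutant π) : H →L[ℂ] H).isClosed_ker) (by
      intro s hs k
      change ((x : bicommutant π) : H →L[ℂ] H) (s (V k)) = 0
      have h := DFunLike.congr_fun (mem_bicommutant_iff.1 (x : bicommutant π).2 s hs) (V k)
      simp only [mul_apply_eq_comp, hVx, map_zero] at h
      exact h.symm) (hgen η)
  rw [← corner_proj (hp := hp)]
  exact h

/-- The roles of algebra and commutant are exchanged: for s, t in π(A)' the operator V⋆s⋆tV commutes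
with ρ(pAp), hence with T in ρ(pAp)''. The extension X of T along S = π(A)' commutes with π(A)', so
X lies in π(A)''. -/
theorem compression_surjective (hV : IsCornerIntertwiner p hp π ρ V) :
    Function.Surjective hV.compression := by
  rintro ⟨T, hT⟩
  have hcomm : ∀ s ∈ (StarSubalgebra.centralizer ℂ (Set.range π) : Set (H →L[ℂ] H)),
      ∀ t ∈ (StarSubalgebra.centralizer ℂ (Set.range π) : Set (H →L[ℂ] H)),
      Commute (adjoint V ∘L adjoint s ∘L t ∘L V) T := by
    intro s hs t ht
    refine mem_bicommutant_iff.1 hT _ (mem_commutant.2 fun x => ?_)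
    have hst := mem_commutant.1 (mul_mem (star_mem hs) ht) (x : A)
    ext k
    have h := DFunLike.congr_fun hst (V k)
    simp only [mul_apply_eq_comp, comp_apply, star_eq_adjoint] at h ⊢
    rw [← hV.adjoint_apply, h, hV.apply_apply]
  obtain ⟨X, hX, hXs, hrange, hzero⟩ := exists_extension _ (fun s hs t ht => mul_mem hs ht)
    (fun s hs => star_mem hs) V hcomm
  -- For s in π(A)', π(p)sV = sπ(p)V = sV, so π(p) is the identity on the generated subspace, which
  -- contains the range of X.
  have hpX : π p * X = X := by
    ext η
    refine generatedSubspace_le (P := LinearMap.eqLocus (π p).toLinearMap LinearMap.id)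
      (isClosed_eq (π p).continuous continuous_id) ?_ (hrange η)
    intro s hs k
    have h := DFunLike.congr_fun (mem_commutant.1 hs p) (V k)
    simp only [mul_apply_eq_comp, hV.apply_proj] at h
    exact h
  -- For the same reason (1 - π(p))H is orthogonal to the generated subspace, where X was set to
  -- zero.
  have hXp : X * π p = X := by
    ext η
    have : η - π p η ∈ (generatedSubspace
        (StarSubalgebra.centralizer ℂ (Set.range π) : Set (H →L[ℂ] H)) V)ᗮ := by
      rw [mem_generatedSubspace_orthogonal]
      intro s hs k
      have h := DFunLike.congr_fun (mem_commutant.1 hs p) (V k)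
      simp only [mul_apply_eq_comp, hV.apply_proj] at h
      rw [inner_sub_right, ← adjoint_inner_left (π p), ← star_eq_adjoint, ← map_star,
        hp.isSelfAdjoint.star_eq, h, sub_self]
    have := hzero _ this
    rw [map_sub, sub_eq_zero] at this
    exact this.symm
  refine ⟨⟨⟨X, mem_bicommutant_iff.2 hXs⟩, ⟨⟨X, mem_bicommutant_iff.2 hXs⟩, ?_⟩⟩, ?_⟩
  · apply Subtype.ext
    change X = π p * X * π p
    rw [hpX, hXp]
  · apply Subtype.ext
    ext k
    have h := hX 1 (one_mem _) k
    simp only [one_apply_eq_self] at h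
    simp [compression, h, hV.adjoint_apply_apply]

/-- The inverse of the compression by `V`. -/
def cornerEquiv (hV : IsCornerIntertwiner p hp π ρ V)
    (hbij : Function.Bijective hV.compression) :
    bicommutant ρ ≃⋆ₐ[ℂ] corner (⟨π p, mem_bicommutant π p⟩ : bicommutant π)
      (isStarProjection_bicommutant π hp) :=
  (StarAlgEquiv.ofBijective hV.compression hbij).symm

theorem cornerEquiv_compression (hV : IsCornerIntertwiner p hp π ρ V)
    (hbij : Function.Bijective hV.compression) :
    hV.cornerEquiv hbij (hV.compression x) = x :=
  (StarAlgEquiv.ofBijective hV.compression hbij).symm_apply_apply x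

end IsCornerIntertwiner

/-- Compression by `V` is compatible with conjugation by unitaries that `V` intertwines. -/
theorem conj_compress {V : K →L[ℂ] H} {u : H ≃ₗᵢ[ℂ] H} {u' : K ≃ₗᵢ[ℂ] K}
    (hu : ∀ k, V (u' k) = u (V k)) (x : H →L[ℂ] H) :
    u'.conjStarAlgEquiv (adjoint V ∘L x ∘L V) = adjoint V ∘L u.conjStarAlgEquiv x ∘L V := by
  have hsymm : ∀ k, V (u'.symm k) = u.symm (V k) := by
    intro k
    rw [LinearIsometryEquiv.eq_symm_apply, ← hu, LinearIsometryEquiv.apply_symm_apply]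
  have hadj : ∀ η, adjoint V (u η) = u' (adjoint V η) := by
    intro η
    refine ext_inner_left ℂ fun k => ?_
    rw [adjoint_inner_right, ← LinearIsometryEquiv.inner_map_map u.symm,
      LinearIsometryEquiv.symm_apply_apply, ← hsymm, ← adjoint_inner_right,
      ← LinearIsometryEquiv.inner_map_map u', LinearIsometryEquiv.apply_symm_apply]
  ext k
  simp only [LinearIsometryEquiv.conjStarAlgEquiv_apply_apply, comp_apply, hadj, ← hsymm]

end Compression

/-! ### Gaussian smoothing -/

section Gaussian

open MeasureTheory Filter

/-- The Gaussian `z ↦ π^(-1/2) exp(-z²)`. -/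
def gaussian (z : ℂ) : ℂ := (√Real.pi : ℂ)⁻¹ * Complex.exp (-z ^ 2)

theorem norm_gaussian (s : ℝ) (z : ℂ) :
    ‖gaussian (s - z)‖ = (√Real.pi)⁻¹ * (Real.exp (z.im ^ 2) * Real.exp (-1 * (s - z.re) ^ 2)) := by
  rw [gaussian, norm_mul, norm_inv, Complex.norm_real, Real.norm_of_nonneg (by positivity),
    Complex.norm_exp, ← Real.exp_add]
  congr 2
  simp [sq]
  ring

theorem continuous_gaussian : Continuous gaussian := by unfold gaussian; fun_prop

theorem hasDerivAt_gaussian (z : ℂ) : HasDerivAt gaussian (-2 * z * gaussian z) z := by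
  have h := (((hasDerivAt_id z).pow 2).neg.cexp).const_mul (√Real.pi : ℂ)⁻¹
  refine h.congr_deriv ?_
  simp [gaussian]
  ring

theorem integrable_shifted_gaussian {b : ℝ} (hb : 0 < b) (r : ℝ) :
    Integrable fun s : ℝ => Real.exp (-b * (s - r) ^ 2) :=
  (integrable_exp_neg_mul_sq hb).comp_sub_right r

theorem integrable_norm_gaussian (z : ℂ) : Integrable fun s : ℝ => ‖gaussian (s - z)‖ := by
  simp only [norm_gaussian]
  exact ((integrable_shifted_gaussian one_pos z.re).const_mul _).const_mul _

theorem integral_norm_gaussian (z : ℂ) : ∫ s : ℝ, ‖gaussian (s - z)‖ = Real.exp (z.im ^ 2) := by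
  simp only [norm_gaussian]
  rw [integral_const_mul, integral_const_mul,
    integral_sub_right_eq_self (fun s => Real.exp (-1 * s ^ 2)) z.re, integral_gaussian, div_one]
  field_simp

theorem integral_gaussian_ofReal : ∫ s : ℝ, gaussian s = 1 := by
  have h : ∀ s : ℝ, gaussian s = ((‖gaussian (s - 0)‖ : ℝ) : ℂ) := by
    intro s
    rw [norm_gaussian, gaussian]
    push_cast
    simp
  simp only [h]
  rw [integral_complex_ofReal, integral_norm_gaussian]
  simp

theorem star_gaussian (z : ℂ) : star (gaussian z) = gaussian (star z) := by
  simp [gaussian, ← Complex.exp_conj]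

/-- A majorant uniform over the unit ball about z₀ and integrable in s, as required for
differentiation under the integral in `differentiable_smoothing`. -/
theorem norm_deriv_gaussian_le {z₀ z : ℂ} (hz : z ∈ Metric.ball z₀ 1) (s : ℝ) :
    ‖2 * (s - z) * gaussian (s - z)‖ ≤
      2 * (2 + |z₀.im|) * (√Real.pi)⁻¹ * Real.exp ((|z₀.im| + 1) ^ 2 + 1)
        * Real.exp (-(1 / 4) * (s - z₀.re) ^ 2) := by
  rw [mem_ball_iff_norm] at hz
  have hre : |z.re - z₀.re| ≤ 1 := (Complex.abs_re_le_norm (z - z₀)).trans hz.le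
  have him : |z.im - z₀.im| ≤ 1 := (Complex.abs_im_le_norm (z - z₀)).trans hz.le
  set x := s - z₀.re with hx
  have h1 : ‖(s : ℂ) - z‖ ≤ |x| + 1 + |z₀.im| := by
    calc ‖(s : ℂ) - z‖ = ‖((s : ℂ) - z₀) - (z - z₀)‖ := by congr 1; ring
      _ ≤ ‖(s : ℂ) - z₀‖ + ‖z - z₀‖ := norm_sub_le _ _
      _ ≤ (|((s : ℂ) - z₀).re| + |((s : ℂ) - z₀).im|) + 1 :=
        add_le_add (Complex.norm_le_abs_re_add_abs_im _) hz.le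
      _ = |x| + 1 + |z₀.im| := by simp [hx]; ring
  -- The linear factor costs exp(x²/4), half of the decay exp(-x²/2) kept in `h6`; exp(-x²/4)
  -- remains.
  have h2 : |x| + 1 + |z₀.im| ≤ (2 + |z₀.im|) * Real.exp (1 / 4 * x ^ 2) := by
    have h3 : 1 / 4 * x ^ 2 + 1 ≤ Real.exp (1 / 4 * x ^ 2) := Real.add_one_le_exp _
    have h4 : |x| ≤ 1 / 4 * x ^ 2 + 1 := by nlinarith [sq_nonneg (|x| / 2 - 1), sq_abs x]
    nlinarith [abs_nonneg z₀.im, sq_nonneg x]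
  have h5 : z.im ^ 2 ≤ (|z₀.im| + 1) ^ 2 := by
    rw [← sq_abs z.im]
    have : |z.im| ≤ |z₀.im| + 1 := by
      have := abs_sub_abs_le_abs_sub z.im z₀.im
      linarith
    gcongr
  -- With d = Re(z - z₀) and |d| ≤ 1, the inequality (x - 2d)² ≥ 0 gives (x - d)² ≥ x²/2 - d².
  have h6 : -1 * (s - z.re) ^ 2 ≤ 1 - 1 / 2 * x ^ 2 := by
    have h7 : (z.re - z₀.re) ^ 2 ≤ 1 := (sq_le_one_iff_abs_le_one _).2 hre
    have h8 : s - z.re = x - (z.re - z₀.re) := by rw [hx]; ring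
    rw [h8]
    nlinarith [sq_nonneg (x - 2 * (z.re - z₀.re))]
  rw [norm_mul, norm_mul, norm_gaussian, ← Real.exp_add]
  calc ‖(2 : ℂ)‖ * ‖(s : ℂ) - z‖ * ((√Real.pi)⁻¹ * Real.exp (z.im ^ 2 + -1 * (s - z.re) ^ 2))
      ≤ 2 * ((2 + |z₀.im|) * Real.exp (1 / 4 * x ^ 2)) * ((√Real.pi)⁻¹ *
        Real.exp ((|z₀.im| + 1) ^ 2 + (1 - 1 / 2 * x ^ 2))) := by
        rw [Complex.norm_ofNat]
        gcongr
        exact h1.trans h2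
    _ = 2 * (2 + |z₀.im|) * (√Real.pi)⁻¹ * (Real.exp (1 / 4 * x ^ 2) *
        Real.exp ((|z₀.im| + 1) ^ 2 + (1 - 1 / 2 * x ^ 2))) := by ring
    _ = _ := by
      rw [← Real.exp_add, mul_assoc _ (Real.exp _), ← Real.exp_add]
      congr 2
      ring

variable {E F : Type*} [NormedAddCommGroup E] [NormedSpace ℂ E]
  [NormedAddCommGroup F] [NormedSpace ℂ F]

/-- The function `z ↦ ∫ π^(-1/2) exp(-(s - z)²) v(s) ds`. -/
def smoothing (v : ℝ → E) (z : ℂ) : E := ∫ s : ℝ, gaussian (s - z) • v s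

theorem integrable_gaussian_smul {v : ℝ → E} (hv : Continuous v) {B : ℝ} (hB : ∀ s, ‖v s‖ ≤ B)
    (z : ℂ) : Integrable fun s : ℝ => gaussian (s - z) • v s := by
  refine ((integrable_norm_gaussian z).mul_const B).mono'
    (Continuous.aestronglyMeasurable ?_) (ae_of_all _ fun s => ?_)
  · exact (continuous_gaussian.comp (by fun_prop)).smul hv
  · rw [norm_smul]
    exact mul_le_mul_of_nonneg_left (hB s) (norm_nonneg _)

theorem norm_smoothing_le {v : ℝ → E} {B : ℝ} (hB : ∀ s, ‖v s‖ ≤ B)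
    (z : ℂ) : ‖smoothing v z‖ ≤ Real.exp (z.im ^ 2) * B := by
  rw [← integral_norm_gaussian, ← integral_mul_const]
  refine norm_integral_le_of_norm_le ((integrable_norm_gaussian z).mul_const B)
    (ae_of_all _ fun s => ?_)
  rw [norm_smul]
  exact mul_le_mul_of_nonneg_left (hB s) (norm_nonneg _)

theorem differentiable_smoothing {v : ℝ → E} (hv : Continuous v) {B : ℝ} (hB : ∀ s, ‖v s‖ ≤ B) :
    Differentiable ℂ (smoothing v) := by
  intro z₀
  have hg : ∀ z : ℂ, Continuous fun s : ℝ => gaussian (s - z) :=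
    fun z => continuous_gaussian.comp (by fun_prop)
  refine (hasDerivAt_integral_of_dominated_loc_of_deriv_le (𝕜 := ℂ)
    (F' := fun z s => (2 * (s - z) * gaussian (s - z)) • v s)
    (bound := fun s => 2 * (2 + |z₀.im|) * (√Real.pi)⁻¹ * Real.exp ((|z₀.im| + 1) ^ 2 + 1)
        * Real.exp (-(1 / 4) * (s - z₀.re) ^ 2) * B)
    (Metric.ball_mem_nhds z₀ one_pos)
    (Eventually.of_forall fun z => ((hg z).smul hv).aestronglyMeasurable)
    (integrable_gaussian_smul hv hB z₀) ?_ ?_ ?_ ?_).2.differentiableAt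
  · exact Continuous.aestronglyMeasurable (by have := hg z₀; fun_prop)
  · refine ae_of_all _ fun s z hz => ?_
    rw [norm_smul]
    exact mul_le_mul (norm_deriv_gaussian_le hz s) (hB s) (norm_nonneg _) (by positivity)
  · exact ((integrable_shifted_gaussian (by norm_num) z₀.re).const_mul _).mul_const _
  · refine ae_of_all _ fun s z _ => ?_
    have h := (hasDerivAt_gaussian (s - z)).comp z
      ((hasDerivAt_const z (s : ℂ)).sub (hasDerivAt_id z))
    exact (h.congr_deriv (by ring)).smul_const (v s)

theorem smoothing_add_ofReal (v : ℝ → E) (z : ℂ) (t : ℝ) :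
    smoothing v (z + t) = smoothing (fun s => v (s + t)) z := by
  unfold smoothing
  rw [← integral_add_right_eq_self _ t]
  congr 1 with s
  congr 2
  push_cast
  ring

theorem smoothing_comp [CompleteSpace E] [CompleteSpace F] (L : E →L[ℂ] F) {v : ℝ → E}
    (hv : Continuous v) {B : ℝ} (hB : ∀ s, ‖v s‖ ≤ B) (z : ℂ) :
    smoothing (fun s => L (v s)) z = L (smoothing v z) := by
  unfold smoothing
  rw [← L.integral_comp_comm (integrable_gaussian_smul hv hB z)]
  simp

theorem star_smoothing [CompleteSpace E] [StarAddMonoid E] [NormedStarGroup E] [StarModule ℂ E]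
    (v : ℝ → E) (z : ℂ) :
    star (smoothing v z) = smoothing (fun s => star (v s)) (star z) := by
  unfold smoothing
  have h := (starL' ℝ (A := E)).integral_comp_comm (μ := volume)
    (fun s : ℝ => gaussian (s - z) • v s)
  simp only [starL'_apply] at h
  rw [← h]
  congr 1 with s
  rw [star_smul, star_gaussian]
  simp

theorem smoothing_const [CompleteSpace E] (x : E) : smoothing (fun _ => x) 0 = x := by
  unfold smoothing
  rw [integral_smul_const]
  simp [integral_gaussian_ofReal]

theorem smoothing_sub {v w : ℝ → E} (hv : Continuous v) {B : ℝ} (hB : ∀ s, ‖v s‖ ≤ B)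
    (hw : Continuous w) {B' : ℝ} (hB' : ∀ s, ‖w s‖ ≤ B') (z : ℂ) :
    smoothing v z - smoothing w z = smoothing (fun s => v s - w s) z := by
  unfold smoothing
  rw [← integral_sub (integrable_gaussian_smul hv hB z) (integrable_gaussian_smul hw hB' z)]
  simp only [smul_sub]

theorem tendsto_smoothing [CompleteSpace E] {v : ℝ → E} (hv : Continuous v) {B : ℝ}
    (hB : ∀ s, ‖v s‖ ≤ B) :
    Tendsto (fun c : ℝ => smoothing (fun s => v (c * s)) 0) (𝓝[>] 0) (𝓝 (v 0)) := by
  rw [← smoothing_const (v 0)]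
  unfold smoothing
  refine tendsto_integral_filter_of_dominated_convergence (fun s : ℝ => ‖gaussian (s - 0)‖ * B)
    (Eventually.of_forall fun c => ?_) (Eventually.of_forall fun c => ae_of_all _ fun s => ?_)
    ((integrable_norm_gaussian 0).mul_const B) (ae_of_all _ fun s => ?_)
  · exact (integrable_gaussian_smul (hv.comp (by fun_prop)) (fun s => hB (c * s)) 0).1
  · rw [norm_smul]
    exact mul_le_mul_of_nonneg_left (hB _) (norm_nonneg _)
  · have h : Continuous fun c : ℝ => gaussian (s - 0) • v (c * s) := by fun_prop
    have h' := (h.tendsto 0).mono_left (nhdsWithin_le_nhds (s := Set.Ioi 0))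
    simpa using h'

end Gaussian

/-! ### Pointwise group law of the flow -/

section OneParamGroup

variable {A : Type*} [NonUnitalCStarAlgebra A]

theorem OneParamGroup.add_apply (α : OneParamGroup A) (s t : ℝ) (a : A) :
    α (s + t) a = α s (α t a) := DFunLike.congr_fun (α.map_add s t) a

theorem OneParamGroup.zero_apply (α : OneParamGroup A) (a : A) : α 0 a = a := by
  have h : α 0 * α 0 = α 0 := by rw [← α.map_add, add_zero]
  rw [mul_eq_left.1 h, StarAlgEquiv.one_apply]

end OneParamGroup

/-! ### The vectors of a GNS construction -/

namespace Weight.GNS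

open Filter

variable {A : Type*} [NonUnitalCStarAlgebra A] [PartialOrder A] [StarOrderedRing A]
  {ψ : Weight A} {H : Type*} [NormedAddCommGroup H] [InnerProductSpace ℂ H] [CompleteSpace H]

open Classical in
/-- The vector `Λ(a)` for `a ∈ 𝒩_ψ`, and `0` for other `a`. -/
def vec (G : ψ.GNS H) (a : A) : H := if h : a ∈ ψ.N then G.Λ ⟨a, h⟩ else 0

theorem vec_of_mem (G : ψ.GNS H) {a : A} (h : a ∈ ψ.N) : G.vec a = G.Λ ⟨a, h⟩ := dif_pos h

theorem inner_vec (G : ψ.GNS H) {a b : A} (ha : a ∈ ψ.N) (hb : b ∈ ψ.N) :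
    ⟪G.vec a, G.vec b⟫_ℂ = ψ.ext (star a * b) := by
  rw [G.vec_of_mem ha, G.vec_of_mem hb, G.inner_Λ]

theorem π_vec (G : ψ.GNS H) (a : A) {b : A} (hb : b ∈ ψ.N) : G.π a (G.vec b) = G.vec (a * b) := by
  rw [G.vec_of_mem hb, G.π_Λ, G.vec_of_mem (ψ.mul_mem_N a hb)]

theorem vec_add (G : ψ.GNS H) {a b : A} (ha : a ∈ ψ.N) (hb : b ∈ ψ.N) :
    G.vec (a + b) = G.vec a + G.vec b := by
  rw [G.vec_of_mem ha, G.vec_of_mem hb, G.vec_of_mem (ψ.N.add_mem ha hb), ← _root_.map_add]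
  rfl

theorem vec_smul (G : ψ.GNS H) (c : ℂ) {a : A} (ha : a ∈ ψ.N) :
    G.vec (c • a) = c • G.vec a := by
  rw [G.vec_of_mem ha, G.vec_of_mem (ψ.N.smul_mem c ha), ← _root_.map_smul]
  rfl

theorem vec_sub (G : ψ.GNS H) {a b : A} (ha : a ∈ ψ.N) (hb : b ∈ ψ.N) :
    G.vec (a - b) = G.vec a - G.vec b := by
  rw [G.vec_of_mem ha, G.vec_of_mem hb, G.vec_of_mem (ψ.N.sub_mem ha hb), ← map_sub]
  rfl

theorem unitary_vec (G : ψ.GNS H) {σ : A ≃⋆ₐ[ℂ] A} (hσ : ψ.IsInvariant σ) {a : A} (ha : a ∈ ψ.N) :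
    G.unitary hσ (G.vec a) = G.vec (σ a) := by
  rw [G.vec_of_mem ha, G.unitary_Λ, G.vec_of_mem]

theorem norm_vec_map (G : ψ.GNS H) {σ : A ≃⋆ₐ[ℂ] A} (hσ : ψ.IsInvariant σ) {a : A} (ha : a ∈ ψ.N) :
    ‖G.vec (σ a)‖ = ‖G.vec a‖ := by
  rw [← G.unitary_vec hσ ha, LinearIsometryEquiv.norm_map]

theorem norm_vec_sq (G : ψ.GNS H) {a : A} (ha : a ∈ ψ.N) :
    ‖G.vec a‖ ^ 2 = (ψ ⟨star a * a, star_mul_self_nonneg a⟩).toReal := by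
  have h := inner_self_eq_norm_sq_to_K (𝕜 := ℂ) (G.vec a)
  rw [G.inner_vec ha ha, ψ.ext_pos (mem_N'.1 ha)] at h
  apply Complex.ofReal_injective
  rw [h]
  push_cast
  rfl

/-- Lower semi-continuity of `ψ`, in terms of the vectors `Λ(a)`. -/
theorem mem_N_of_tendsto (G : ψ.GNS H) (hψ : ψ.IsProper) {ι : Type*} {l : Filter ι} [l.NeBot]
    {u : ι → A} {a : A} (hu : Tendsto u l (𝓝 a)) {C : ℝ}
    (hC : ∀ᶠ i in l, u i ∈ ψ.N ∧ ‖G.vec (u i)‖ ≤ C) : a ∈ ψ.N ∧ ‖G.vec a‖ ≤ C := by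
  have hC0 : 0 ≤ C := by
    obtain ⟨i, hi⟩ := hC.exists
    exact (norm_nonneg _).trans hi.2
  have hlim : Tendsto (fun i => (⟨star (u i) * u i, star_mul_self_nonneg _⟩ : {a : A // 0 ≤ a})) l
      (𝓝 ⟨star a * a, star_mul_self_nonneg a⟩) :=
    tendsto_subtype_rng.2 (hu.star.mul hu)
  have h : ψ ⟨star a * a, star_mul_self_nonneg a⟩ ≤ ENNReal.ofReal (C ^ 2) := by
    refine (hψ.closed (C ^ 2) (sq_nonneg C)).mem_of_tendsto hlim ?_
    filter_upwards [hC] with i hi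
    rw [ENNReal.le_ofReal_iff_toReal_le (mem_N.1 hi.1).ne (sq_nonneg C),
      ← G.norm_vec_sq hi.1]
    gcongr
    exact hi.2
  have ha : a ∈ ψ.N := h.trans_lt ENNReal.ofReal_lt_top
  refine ⟨ha, le_of_sq_le_sq ?_ hC0⟩
  rw [G.norm_vec_sq ha]
  exact (ENNReal.le_ofReal_iff_toReal_le (mem_N.1 ha).ne (sq_nonneg C)).1 h

/-- The graph of `Λ`. -/
def graph (G : ψ.GNS H) : Submodule ℂ (A × H) where
  carrier := {x | x.1 ∈ ψ.N ∧ G.vec x.1 = x.2}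
  zero_mem' := ⟨ψ.N.zero_mem, by
    rw [Prod.fst_zero, G.vec_of_mem ψ.N.zero_mem]; exact G.Λ.map_zero⟩
  add_mem' {x y} hx hy := ⟨ψ.N.add_mem hx.1 hy.1, by
    rw [Prod.fst_add, G.vec_add hx.1 hy.1, hx.2, hy.2, Prod.snd_add]⟩
  smul_mem' c x hx := ⟨ψ.N.smul_mem c hx.1, by
    rw [Prod.smul_fst, G.vec_smul c hx.1, hx.2, Prod.smul_snd]⟩

/-- Closedness of Λ is the operator form of lower semi-continuity. It allows Bochner integrals to be
taken in the graph, so that Λ commutes with smoothing. -/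
theorem isClosed_graph (G : ψ.GNS H) (hψ : ψ.IsProper) : IsClosed (G.graph : Set (A × H)) := by
  rw [← isSeqClosed_iff_isClosed]
  intro u x hu hx
  have hx1 : Tendsto (fun n => (u n).1) atTop (𝓝 x.1) := (continuous_fst.tendsto x).comp hx
  have hx2 : Tendsto (fun n => G.vec (u n).1) atTop (𝓝 x.2) := by
    have := (continuous_snd.tendsto x).comp hx
    exact this.congr fun n => (hu n).2.symm
  -- Here n is fixed and m tends to infinity in u_n - u_m; the Cauchy property of Λ(u_n) supplies
  -- the bound for `mem_N_of_tendsto`.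
  have key : ∀ ε > 0, ∀ᶠ n in atTop, (u n).1 - x.1 ∈ ψ.N ∧ ‖G.vec ((u n).1 - x.1)‖ ≤ ε := by
    intro ε hε
    obtain ⟨n₀, hn₀⟩ := Metric.cauchySeq_iff.1 hx2.cauchySeq ε hε
    filter_upwards [eventually_ge_atTop n₀] with n hn
    refine G.mem_N_of_tendsto hψ (hx1.const_sub _) ?_
    filter_upwards [eventually_ge_atTop n₀] with m hm
    refine ⟨ψ.N.sub_mem (hu n).1 (hu m).1, ?_⟩
    rw [G.vec_sub (hu n).1 (hu m).1, ← dist_eq_norm]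
    exact (hn₀ n hn m hm).le
  have hmem : x.1 ∈ ψ.N := by
    obtain ⟨n, hn⟩ := (key 1 one_pos).exists
    simpa using ψ.N.sub_mem (hu n).1 hn.1
  refine ⟨hmem, tendsto_nhds_unique ?_ hx2⟩
  rw [Metric.tendsto_atTop']
  intro ε hε
  obtain ⟨n₀, hn₀⟩ := eventually_atTop.1 (key (ε / 2) (half_pos hε))
  refine ⟨n₀, fun n hn => ?_⟩
  rw [dist_eq_norm, ← G.vec_sub (hu n).1 hmem]
  exact (hn₀ n hn.le).2.trans_lt (half_lt_self hε)

end Weight.GNS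

/-! ### Density of 𝒩_ψ ∩ 𝒩_ψ⋆ and continuity of the flow on vectors -/

namespace Weight

variable {A : Type*} [NonUnitalCStarAlgebra A] [PartialOrder A] [StarOrderedRing A]

/-- For a = s⋆s one has a² = s⋆(ss⋆)s ≤ ‖ss⋆‖ a. -/
theorem mem_N_of_finitePos (ψ : Weight A) {a : A} (ha : a ∈ ψ.finitePos) : a ∈ ψ.N := by
  rw [mem_N']
  obtain ⟨s, rfl⟩ := CStarAlgebra.nonneg_iff_eq_star_mul_self.1 ha.1
  have h := ψ.finitePos_smul (norm_nonneg (s * star s)) ha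
  refine ψ.finitePos_of_le (star_mul_self_nonneg _) ?_ h
  have h1 : star s * (s * star s) * s ≤ ‖s * star s‖ • (star s * s) :=
    CStarAlgebra.star_left_conjugate_le_norm_smul
  simpa [mul_assoc] using h1

/-- `𝒩_ψ ∩ 𝒩_ψ⋆`. -/
def Nsym (ψ : Weight A) : Submodule ℂ A where
  carrier := {a | a ∈ ψ.N ∧ star a ∈ ψ.N}
  zero_mem' := ⟨ψ.N.zero_mem, by rw [star_zero]; exact ψ.N.zero_mem⟩
  add_mem' ha hb := ⟨ψ.N.add_mem ha.1 hb.1, by rw [star_add]; exact ψ.N.add_mem ha.2 hb.2⟩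
  smul_mem' c a ha := ⟨ψ.N.smul_mem c ha.1, by rw [star_smul]; exact ψ.N.smul_mem _ ha.2⟩

theorem star_mem_Nsym {ψ : Weight A} {a : A} (ha : a ∈ ψ.Nsym) : star a ∈ ψ.Nsym :=
  ⟨ha.2, by rw [star_star]; exact ha.1⟩

/-- Positive elements of finite weight are self-adjoint members of 𝒩_ψ and are dense in the positive
cone, which spans A. -/
theorem IsProper.mem_closure_Nsym {ψ : Weight A} (hψ : ψ.IsProper) (a : A) :
    a ∈ closure (ψ.Nsym : Set A) := by
  have h : (⊤ : Submodule ℂ A) ≤ ψ.Nsym.topologicalClosure := by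
    rw [← CStarAlgebra.span_nonneg, Submodule.span_le]
    intro b hb
    have h1 := hψ.dense ⟨b, hb⟩
    have h2 := (map_mem_closure continuous_subtype_val h1 (t := (ψ.Nsym : Set A)) ?_)
    · exact h2
    · intro c hc
      have hc' := ψ.mem_N_of_finitePos ⟨c.2, hc⟩
      exact ⟨hc', by rw [star_pos]; exact hc'⟩
  exact h trivial

/-- The KMS function of the pair (y⋆, y) is t ↦ ⟨Λ(y), Λ(α_t(y))⟩ on the real line, hence this is
continuous; weak continuity of a unitary orbit upgrades to norm continuity. -/
theorem IsKMS.continuous_vec {ψ : Weight A} {α : OneParamGroup A} {β : ℝ} (hψ : ψ.IsKMS α β)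
    {H : Type*} [NormedAddCommGroup H] [InnerProductSpace ℂ H] [CompleteSpace H] (G : ψ.GNS H)
    {y : A} (hy : y ∈ ψ.Nsym) : Continuous fun t => G.vec (α t y) := by
  obtain ⟨F, hF, -, -, hFt⟩ := hψ.kms (star y) y hy.2 (by rw [star_star]; exact hy.1) hy.1 hy.2
  have hmem : ∀ t, α t y ∈ ψ.N := fun t => (hψ.invariant t).mem_N.2 hy.1
  have hcont : Continuous fun t : ℝ => ⟪G.vec y, G.vec (α t y)⟫_ℂ := by
    have h1 : Continuous fun t : ℝ => F t :=
      hF.comp_continuous Complex.continuous_ofReal fun t => by simp [strip]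
    refine h1.congr fun t => ?_
    rw [G.inner_vec hy.1 (hmem t), (hFt t).1]
  rw [continuous_iff_continuousAt]
  intro s
  rw [ContinuousAt, tendsto_iff_norm_sub_tendsto_zero]
  have hsq : ∀ t, ‖G.vec (α t y) - G.vec (α s y)‖ ^ 2
      = 2 * ‖G.vec y‖ ^ 2 - 2 * (⟪G.vec y, G.vec (α (t - s) y)⟫_ℂ).re := by
    intro t
    have e1 : α t y = α s (α (t - s) y) := by rw [← α.add_apply]; congr 2; ring
    rw [e1, ← G.unitary_vec (hψ.invariant s) (hmem _), ← G.unitary_vec (hψ.invariant s) hy.1,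
      ← map_sub, LinearIsometryEquiv.norm_map, @norm_sub_sq ℂ, G.norm_vec_map (hψ.invariant _) hy.1,
      inner_re_symm]
    simp only [RCLike.re_to_complex]
    ring
  have h0 : Filter.Tendsto (fun t => ‖G.vec (α t y) - G.vec (α s y)‖ ^ 2) (𝓝 s) (𝓝 0) := by
    simp only [hsq]
    have h1 : Continuous fun t : ℝ => 2 * ‖G.vec y‖ ^ 2
        - 2 * (⟪G.vec y, G.vec (α (t - s) y)⟫_ℂ).re := by
      have := hcont.comp (continuous_id.sub (continuous_const (y := s)))
      exact continuous_const.sub (continuous_const.mul (Complex.continuous_re.comp this))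
    have h2 := h1.tendsto s
    simp only [sub_self, α.zero_apply] at h2
    convert h2 using 2
    have := @inner_self_eq_norm_sq ℂ _ _ _ _ (G.vec y)
    simp only [RCLike.re_to_complex] at this
    rw [this]
    ring
  have h3 := h0.sqrt
  simpa using h3

/-- For a in 𝒩_ψ ∩ 𝒩_ψ⋆ and b in 𝒩_ψ the product ab is again in 𝒩_ψ ∩ 𝒩_ψ⋆, so the closure contains
π(a)H for such a, then for all a by density, and non-degeneracy finishes. -/
theorem GNS.dense_vec_Nsym {ψ : Weight A} {H : Type*} [NormedAddCommGroup H]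
    [InnerProductSpace ℂ H] [CompleteSpace H] (G : ψ.GNS H) (hψ : ψ.IsProper) :
    Dense (G.vec '' (ψ.Nsym : Set A)) := by
  let P : Submodule ℂ H :=
    { carrier := G.vec '' (ψ.Nsym : Set A)
      zero_mem' := ⟨0, ψ.Nsym.zero_mem, by rw [G.vec_of_mem ψ.N.zero_mem]; exact G.Λ.map_zero⟩
      add_mem' := by
        rintro _ _ ⟨a, ha, rfl⟩ ⟨b, hb, rfl⟩
        exact ⟨a + b, ψ.Nsym.add_mem ha hb, G.vec_add ha.1 hb.1⟩
      smul_mem' := by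
        rintro c _ ⟨a, ha, rfl⟩
        exact ⟨c • a, ψ.Nsym.smul_mem c ha, G.vec_smul c ha.1⟩ }
  have h1 : ∀ a ∈ ψ.Nsym, ∀ η, G.π a η ∈ P.topologicalClosure := by
    intro a ha η
    refine map_mem_closure (G.π a).continuous (G.denseRange η) ?_
    rintro _ ⟨b, rfl⟩
    refine ⟨a * b, ⟨ψ.mul_mem_N a b.2, ?_⟩, ?_⟩
    · rw [star_mul]; exact ψ.mul_mem_N _ ha.2
    · rw [← G.π_vec a b.2, G.vec_of_mem b.2]
  have h2 : ∀ a η, G.π a η ∈ P.topologicalClosure := by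
    intro a η
    have hcont : Continuous fun a => G.π a η :=
      (map_continuous G.π).clm_apply continuous_const
    have h := map_mem_closure hcont (hψ.mem_closure_Nsym a)
      (t := (P.topologicalClosure : Set H)) fun a ha => h1 a ha η
    rwa [(Submodule.isClosed_topologicalClosure P).closure_eq] at h
  have h3 : Submodule.span ℂ {η : H | ∃ a ζ, η = G.π a ζ} ≤ P.topologicalClosure := by
    rw [Submodule.span_le]
    rintro _ ⟨a, ζ, rfl⟩
    exact h2 a ζ
  have h4 : Dense (P.topologicalClosure : Set H) := G.nondegenerate.mono h3
  have h5 : Dense (closure (P : Set H)) := h4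
  exact dense_closure.1 h5

end Weight

/-! ### Analytic elements -/

open Complex.HadamardThreeLines in
/-- A bounded continuous function on the strip that is holomorphic in the interior is determined by
its values on the real line. -/
theorem eq_of_eqOn_real {β : ℝ} {F F' : ℂ → ℂ} (hF : ContinuousOn F (strip β)) {C : ℝ}
    (hC : ∀ z ∈ strip β, ‖F z‖ ≤ C) (hFd : DifferentiableOn ℂ F (interior (strip β)))
    (hF' : Differentiable ℂ F') {C' : ℝ} (hC' : ∀ z ∈ strip β, ‖F' z‖ ≤ C')
    (h : ∀ t : ℝ, F t = F' t) : F (β * Complex.I) = F' (β * Complex.I) := by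
  -- For β = 0 the strip is the real line and has empty interior.
  rcases eq_or_ne β 0 with rfl | hβ
  · simpa using h 0
  -- The substitution z = iβw takes 0 ≤ Re w ≤ 1 to the strip for either sign of β, with Re w = 0
  -- going to the real line.
  set f : ℂ → ℂ := fun w => F (β * Complex.I * w) - F' (β * Complex.I * w) with hf
  have him : ∀ w : ℂ, ((β : ℂ) * Complex.I * w).im = β * w.re := by intro w; simp
  have hmaps : Set.MapsTo (fun w : ℂ => (β : ℂ) * Complex.I * w) (verticalClosedStrip 0 1)
      (strip β) := by
    intro w hw
    have hw' : w.re ∈ Set.Icc (0 : ℝ) 1 := hw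
    change ((β : ℂ) * Complex.I * w).im ∈ Set.uIcc 0 β
    rw [him, Set.mem_uIcc]
    rcases le_total 0 β with h0 | h0
    · left; constructor <;> nlinarith [hw'.1, hw'.2]
    · right; constructor <;> nlinarith [hw'.1, hw'.2]
  have hmaps' : Set.MapsTo (fun w : ℂ => (β : ℂ) * Complex.I * w) (verticalStrip 0 1)
      (interior (strip β)) := by
    intro w hw
    have hw' : w.re ∈ Set.Ioo (0 : ℝ) 1 := hw
    refine preimage_interior_subset_interior_preimage Complex.continuous_im ?_
    change ((β : ℂ) * Complex.I * w).im ∈ interior (Set.uIcc 0 β)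
    rw [him]
    rcases lt_or_gt_of_ne hβ with h0 | h0
    · rw [Set.uIcc_of_ge h0.le, interior_Icc]
      constructor <;> nlinarith [hw'.1, hw'.2]
    · rw [Set.uIcc_of_le h0.le, interior_Icc]
      constructor <;> nlinarith [hw'.1, hw'.2]
  have hcl : closure (verticalStrip 0 1) ⊆ verticalClosedStrip 0 1 :=
    closure_minimal (Set.preimage_mono Set.Ioo_subset_Icc_self)
      (isClosed_Icc.preimage Complex.continuous_re)
  have hcont : ContinuousOn f (verticalClosedStrip 0 1) :=
    (hF.comp (by fun_prop) hmaps).sub (hF'.continuous.comp (by fun_prop)).continuousOn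
  have hd : DiffContOnCl ℂ f (verticalStrip 0 1) :=
    ⟨(hFd.comp (by fun_prop) hmaps').sub (hF'.comp (by fun_prop)).differentiableOn,
      hcont.mono hcl⟩
  have hbound : ∀ w ∈ verticalClosedStrip 0 1, ‖f w‖ ≤ C + C' := fun w hw =>
    (norm_sub_le _ _).trans (add_le_add (hC _ (hmaps hw)) (hC' _ (hmaps hw)))
  have hzero : Set.EqOn f 0 (verticalStrip 0 1) := by
    intro w hw
    have hw' : w.re ∈ Set.Ioo (0 : ℝ) 1 := hw
    have key := norm_le_interp_of_mem_verticalClosedStrip' (f := f) (a := 0) (b := C + C')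
      one_pos (Set.preimage_mono Set.Ioo_subset_Icc_self hw) hd
      ⟨C + C', by rintro _ ⟨w, hw, rfl⟩; exact hbound w hw⟩ (by
        intro w hw
        have hw0 : w.re = 0 := hw
        have e : (β : ℂ) * Complex.I * w = ((-β * w.im : ℝ) : ℂ) := by
          apply Complex.ext <;> simp [hw0]
        simp only [hf, e, h, sub_self, norm_zero, le_refl]) (by
        intro w hw
        have hw1 : w.re = 1 := hw
        exact hbound w (by change w.re ∈ Set.Icc (0 : ℝ) 1; rw [hw1]; simp))
    -- The three lines bound is 0^(1 - Re w)·(C + C')^(Re w), which vanishes only for Re w < 1. The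
    -- endpoint w = 1, that is z = iβ, is then reached by continuity.
    rw [Real.zero_rpow (by simp; linarith [hw'.2]), zero_mul] at key
    exact norm_le_zero_iff.1 key
  have h1 : (1 : ℂ) ∈ closure (verticalStrip 0 1) := by
    have hlim : Filter.Tendsto (fun r : ℝ => (r : ℂ)) (𝓝[<] 1) (𝓝 1) := by
      have := (Complex.continuous_ofReal.tendsto 1).mono_left (nhdsWithin_le_nhds (s := Set.Iio 1))
      simpa using this
    refine mem_closure_of_tendsto hlim ?_
    filter_upwards [Ioo_mem_nhdsLT (zero_lt_one' ℝ)] with r hr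
    exact hr
  have h2 := hzero.of_subset_closure (hcont.mono hcl) continuousOn_const subset_closure le_rfl h1
  simp only [hf, mul_one, Pi.zero_apply, sub_eq_zero] at h2
  exact h2

section Analytic

variable {A : Type*} [NonUnitalCStarAlgebra A]

/-- `z ↦ c(z)` is the entire extension of an orbit of `α`. -/
structure IsEntireOrbit (α : OneParamGroup A) (c : ℂ → A) : Prop where
  differentiable : Differentiable ℂ c
  add_ofReal : ∀ (z : ℂ) (t : ℝ), c (z + t) = α t (c z)

/-- The function `z ↦ c(z̄)⋆`. -/
def dagger (c : ℂ → A) (z : ℂ) : A := star (c (star z))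

theorem dagger_mul (c d : ℂ → A) :
    dagger (fun z => c z * d z) = fun z => dagger d z * dagger c z := by
  funext z; simp [dagger]

namespace IsEntireOrbit

variable {α : OneParamGroup A} {c d : ℂ → A}

theorem dagger (hc : IsEntireOrbit α c) : IsEntireOrbit α (dagger c) where
  differentiable z := differentiableAt_star_conj_iff.2 (hc.differentiable _)
  add_ofReal z t := by
    have h := hc.add_ofReal (star z) t
    simp only [KMSCorner.dagger, star_add, Complex.star_def, Complex.conj_ofReal] at h ⊢
    rw [h, map_star]

theorem mul (hc : IsEntireOrbit α c) (hd : IsEntireOrbit α d) :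
    IsEntireOrbit α fun z => c z * d z where
  differentiable :=
    ((ContinuousLinearMap.mul ℂ A).differentiable.comp hc.differentiable).clm_apply
      hd.differentiable
  add_ofReal z t := by rw [hc.add_ofReal, hd.add_ofReal, map_mul]

theorem add (hc : IsEntireOrbit α c) (hd : IsEntireOrbit α d) :
    IsEntireOrbit α fun z => c z + d z where
  differentiable := hc.differentiable.add hd.differentiable
  add_ofReal z t := by rw [hc.add_ofReal, hd.add_ofReal, map_add]

theorem smul (hc : IsEntireOrbit α c) (r : ℂ) : IsEntireOrbit α fun z => r • c z where
  differentiable := hc.differentiable.const_smul r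
  add_ofReal z t := by rw [hc.add_ofReal, map_smul]

theorem shift (hc : IsEntireOrbit α c) (u : ℂ) : IsEntireOrbit α fun z => c (z + u) where
  differentiable := hc.differentiable.comp (by fun_prop)
  add_ofReal z t := by rw [add_right_comm, hc.add_ofReal]

theorem const {m : A} (hm : ∀ t, α t m = m) : IsEntireOrbit α fun _ => m where
  differentiable := by fun_prop
  add_ofReal z t := (hm t).symm

theorem apply_ofReal (hc : IsEntireOrbit α c) (t : ℝ) : c t = α t (c 0) := by
  have := hc.add_ofReal 0 t
  rwa [zero_add] at this

end IsEntireOrbit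

end Analytic

/-! ### Analytic elements of 𝒩_ψ and the KMS condition at complex times -/

namespace Weight.GNS

variable {A : Type*} [NonUnitalCStarAlgebra A] [PartialOrder A] [StarOrderedRing A]
  {ψ : Weight A} {H : Type*} [NormedAddCommGroup H] [InnerProductSpace ℂ H] [CompleteSpace H]

/-- An entire orbit in `𝒩_ψ` whose image under `Λ` is entire. -/
structure IsEntire (G : ψ.GNS H) (α : OneParamGroup A) (c : ℂ → A) : Prop
    extends IsEntireOrbit α c where
  mem : ∀ z, c z ∈ ψ.N
  differentiable_vec : Differentiable ℂ fun z => G.vec (c z)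

/-- An entire orbit in `𝒩_ψ ∩ 𝒩_ψ⋆` whose image under `Λ`, and that of its adjoint, is entire. -/
structure IsSymEntire (G : ψ.GNS H) (α : OneParamGroup A) (c : ℂ → A) : Prop where
  isEntire : G.IsEntire α c
  isEntire_dagger : G.IsEntire α (dagger c)

variable {G : ψ.GNS H} {α : OneParamGroup A} {β : ℝ} {c d : ℂ → A}

theorem differentiable_π_apply (G : ψ.GNS H) (hc : Differentiable ℂ c) {v : ℂ → H}
    (hv : Differentiable ℂ v) : Differentiable ℂ fun z => G.π (c z) (v z) := by
  let P : A →L[ℂ] (H →L[ℂ] H) :=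
    { toFun := G.π, map_add' := _root_.map_add G.π, map_smul' := _root_.map_smul G.π,
      cont := map_continuous G.π }
  exact (P.differentiable.comp hc).clm_apply hv

namespace IsEntire

theorem mul_left (hd : G.IsEntire α d) (hc : IsEntireOrbit α c) :
    G.IsEntire α fun z => c z * d z where
  toIsEntireOrbit := hc.mul hd.toIsEntireOrbit
  mem z := ψ.mul_mem_N _ (hd.mem z)
  differentiable_vec := by
    simp only [← G.π_vec _ (hd.mem _)]
    exact G.differentiable_π_apply hc.differentiable hd.differentiable_vec

theorem add (hc : G.IsEntire α c) (hd : G.IsEntire α d) : G.IsEntire α fun z => c z + d z where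
  toIsEntireOrbit := hc.toIsEntireOrbit.add hd.toIsEntireOrbit
  mem z := ψ.N.add_mem (hc.mem z) (hd.mem z)
  differentiable_vec := by
    simp only [G.vec_add (hc.mem _) (hd.mem _)]
    exact hc.differentiable_vec.add hd.differentiable_vec

theorem smul (hc : G.IsEntire α c) (r : ℂ) : G.IsEntire α fun z => r • c z where
  toIsEntireOrbit := hc.toIsEntireOrbit.smul r
  mem z := ψ.N.smul_mem r (hc.mem z)
  differentiable_vec := by
    simp only [G.vec_smul r (hc.mem _)]
    exact hc.differentiable_vec.const_smul r

theorem shift (hc : G.IsEntire α c) (u : ℂ) : G.IsEntire α fun z => c (z + u) where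
  toIsEntireOrbit := hc.toIsEntireOrbit.shift u
  mem z := hc.mem _
  differentiable_vec := hc.differentiable_vec.comp (f := fun z => z + u) (by fun_prop)

theorem const {m : A} (hm : ∀ t, α t m = m) (hmN : m ∈ ψ.N) : G.IsEntire α fun _ => m where
  toIsEntireOrbit := IsEntireOrbit.const hm
  mem _ := hmN
  differentiable_vec := by fun_prop

/-- A real translation acts unitarily, so the norm depends only on Im z, which ranges over a compact
interval. -/
theorem norm_vec_bounded (hc : G.IsEntire α c) (hinv : ∀ t, ψ.IsInvariant (α t)) (β : ℝ) :
    ∃ C, ∀ z ∈ strip β, ‖G.vec (c z)‖ ≤ C := by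
  have hcont : Continuous fun y : ℝ => G.vec (c (y * Complex.I)) :=
    hc.differentiable_vec.continuous.comp (by fun_prop)
  obtain ⟨C, hC⟩ := isCompact_uIcc.exists_bound_of_continuousOn
    hcont.continuousOn (s := Set.uIcc 0 β)
  refine ⟨C, fun z hz => ?_⟩
  have e : z = z.im * Complex.I + (z.re : ℝ) := by rw [add_comm, Complex.re_add_im]
  rw [e, hc.add_ofReal, G.norm_vec_map (hinv _) (hc.mem _)]
  exact hC _ hz

/-- Invariance under the group, continued to complex times. -/
theorem inner_shift (hc : G.IsEntire α c) (hinv : ∀ t, ψ.IsInvariant (α t)) (u v z : ℂ) :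
    ⟪G.vec (c (u + star z)), G.vec (c v)⟫_ℂ = ⟪G.vec (c u), G.vec (c (v - z))⟫_ℂ := by
  let f : ℂ → ℂ := fun z => ⟪G.vec (c (u + star z)), G.vec (c v)⟫_ℂ
  let g : ℂ → ℂ := fun z => ⟪G.vec (c u), G.vec (c (v - z))⟫_ℂ
  have hf : Differentiable ℂ f := by
    -- The inner product is conjugate-linear on the left, so f(z) is the conjugate of this entire
    -- function at the conjugate of z, and is itself entire.
    have h1 : Differentiable ℂ fun z => ⟪G.vec (c v), G.vec (c (u + z))⟫_ℂ :=
      (innerSL ℂ (G.vec (c v))).differentiable.comp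
        (hc.differentiable_vec.comp (f := fun z => u + z) (by fun_prop))
    intro z
    have h2 := (differentiableAt_star_conj_iff (x := z)).2 (h1 _)
    refine h2.congr_of_eventuallyEq (Filter.Eventually.of_forall fun w => ?_)
    exact (inner_conj_symm _ _).symm
  have hg : Differentiable ℂ g := (innerSL ℂ (G.vec (c u))).differentiable.comp
    (hc.differentiable_vec.comp (f := fun z => v - z) (by fun_prop))
  have hreal : ∀ t : ℝ, f t = g t := by
    intro t
    have e1 : c (u + star (t : ℂ)) = α t (c u) := by
      rw [Complex.star_def, Complex.conj_ofReal, hc.add_ofReal]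
    have e2 : c v = α t (c (v - t)) := by rw [← hc.add_ofReal, sub_add_cancel]
    change ⟪G.vec (c (u + star (t : ℂ))), G.vec (c v)⟫_ℂ = _
    rw [e1, e2, ← G.unitary_vec (hinv t) (hc.mem _), ← G.unitary_vec (hinv t) (hc.mem _),
      LinearIsometryEquiv.inner_map_map]
  -- The identity theorem applies because the real points, where f and g agree, accumulate at 0.
  have hfreq : ∃ᶠ z in 𝓝[≠] (0 : ℂ), f z = g z := by
    have hlim : Filter.Tendsto (fun t : ℝ => (t : ℂ)) (𝓝[≠] 0) (𝓝[≠] 0) := by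
      refine tendsto_nhdsWithin_iff.2 ⟨?_, ?_⟩
      · have := (Complex.continuous_ofReal.tendsto 0).mono_left
          (nhdsWithin_le_nhds (s := {(0 : ℝ)}ᶜ))
        simpa using this
      · filter_upwards [self_mem_nhdsWithin] with t ht
        simpa using ht
    exact hlim.frequently (Filter.Eventually.of_forall hreal).frequently
  exact congrFun (AnalyticOnNhd.eq_of_frequently_eq (fun z _ => hf.analyticAt z)
    (fun z _ => hg.analyticAt z) hfreq) z

end IsEntire

namespace IsSymEntire

theorem mem_Nsym (hc : G.IsSymEntire α c) (z : ℂ) : c z ∈ ψ.Nsym :=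
  ⟨hc.isEntire.mem z, by simpa [dagger] using hc.isEntire_dagger.mem (star z)⟩

theorem mul (hc : G.IsSymEntire α c) (hd : G.IsEntire α d) :
    G.IsSymEntire α fun z => c z * d z where
  isEntire := hd.mul_left hc.isEntire.toIsEntireOrbit
  isEntire_dagger := by
    rw [dagger_mul]
    exact hc.isEntire_dagger.mul_left hd.toIsEntireOrbit.dagger

theorem add (hc : G.IsSymEntire α c) (hd : G.IsSymEntire α d) :
    G.IsSymEntire α fun z => c z + d z where
  isEntire := hc.isEntire.add hd.isEntire
  isEntire_dagger := by
    convert hc.isEntire_dagger.add hd.isEntire_dagger using 2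
    simp [dagger]

theorem smul (hc : G.IsSymEntire α c) (r : ℂ) : G.IsSymEntire α fun z => r • c z where
  isEntire := hc.isEntire.smul r
  isEntire_dagger := by
    convert hc.isEntire_dagger.smul (star r) using 2
    simp [dagger]

theorem shift (hc : G.IsSymEntire α c) (u : ℂ) : G.IsSymEntire α fun z => c (z + u) where
  isEntire := hc.isEntire.shift u
  isEntire_dagger := by
    convert hc.isEntire_dagger.shift (star u) using 2
    simp [dagger]

theorem const {m : A} (hm : ∀ t, α t m = m) (hmN : m ∈ ψ.Nsym) : G.IsSymEntire α fun _ => m where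
  isEntire := IsEntire.const hm hmN.1
  isEntire_dagger := IsEntire.const (fun t => (map_star (α t) m).trans (congrArg star (hm t))) hmN.2

/-- The KMS condition for analytic elements: `ψ(c(0) a) = ψ(a c(iβ))`. -/
theorem kms (hψ : ψ.IsKMS α β) (hc : G.IsSymEntire α c) {a : A} (ha : a ∈ ψ.Nsym) :
    ⟪G.vec (star (c 0)), G.vec a⟫_ℂ = ⟪G.vec (star a), G.vec (c (β * Complex.I))⟫_ℂ := by
  obtain ⟨F, hF, ⟨C, hC⟩, hFd, hFt⟩ := hψ.kms a (c 0) ha.1 ha.2 (hc.mem_Nsym 0).1 (hc.mem_Nsym 0).2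
  obtain ⟨C', hC'⟩ := hc.isEntire.norm_vec_bounded hψ.invariant β
  -- The abstract KMS function of the pair (a, c(0)) agrees on the real line with the explicit
  -- entire function z ↦ ⟨Λ(a⋆), Λ(c(z))⟩, so its value at iβ may be computed from the latter.
  have h := eq_of_eqOn_real (F' := fun z => ⟪G.vec (star a), G.vec (c z)⟫_ℂ) hF hC hFd
    ((innerSL ℂ (G.vec (star a))).differentiable.comp hc.isEntire.differentiable_vec)
    (C' := ‖G.vec (star a)‖ * C')
    (fun z hz => (norm_inner_le_norm _ _).trans (by gcongr; exact hC' z hz)) (by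
      intro t
      rw [(hFt t).1, G.inner_vec ha.2 (hc.isEntire.mem t), star_star, hc.isEntire.apply_ofReal])
  have h0 := (hFt 0).2
  rw [Complex.ofReal_zero, zero_add, α.zero_apply] at h0
  rw [← h, h0, G.inner_vec (hc.mem_Nsym 0).2 ha.1, star_star]

/-- `ψ(c(iβ/2)⋆ c(iβ/2)) = ψ(c(0) c(0)⋆)`. -/
theorem norm_vec_half (hψ : ψ.IsKMS α β) (hc : G.IsSymEntire α c) :
    ‖G.vec (c (β / 2 * Complex.I))‖ = ‖G.vec (star (c 0))‖ := by
  set h : ℂ := β / 2 * Complex.I with hh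
  have hstar : star h = -h := by simp [hh]
  -- With h = iβ/2, so that iβ - h = h, the KMS identity for the orbit shifted by -h and the element
  -- c(h)⋆ reads ⟨Λ(c(-h)⋆), Λ(c(h)⋆)⟩ = ‖Λ(c(h))‖².
  have h1 := kms hψ (hc.shift (-h)) (star_mem_Nsym (hc.mem_Nsym h))
  have e : (β : ℂ) * Complex.I + -h = h := by rw [hh]; ring
  rw [zero_add, star_star, e] at h1
  -- As the conjugate of h is -h, the vectors on the left of `h1` are those of `dagger c` at h and
  -- -h; invariance at imaginary time moves both to 0.
  have h2 := hc.isEntire_dagger.inner_shift hψ.invariant 0 (-h) (-h)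
  simp only [dagger, star_neg, hstar, neg_neg, zero_add, sub_self, star_zero] at h2
  rw [h1, inner_self_eq_norm_sq_to_K, inner_self_eq_norm_sq_to_K] at h2
  have h3 : ‖G.vec (c h)‖ ^ 2 = ‖G.vec (star (c 0))‖ ^ 2 := by
    apply Complex.ofReal_injective
    push_cast
    exact h2
  exact (sq_eq_sq₀ (norm_nonneg _) (norm_nonneg _)).1 h3

/-- Right multiplication by an analytic element is bounded. -/
theorem norm_vec_mul_le (hψ : ψ.IsKMS α β) (hc : G.IsSymEntire α c) (hd : G.IsEntire α d) :
    ‖G.vec (c 0 * d 0)‖ ≤ ‖d (-(β / 2 * Complex.I))‖ * ‖G.vec (c 0)‖ := by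
  set h : ℂ := β / 2 * Complex.I with hh
  -- The adjoint turns right multiplication into left multiplication: ‖Λ(c(0)d(0))‖ =
  -- ‖π(d(-h)⋆)Λ(c(-h)⋆)‖, while ‖Λ(c(-h)⋆)‖ = ‖Λ(c(0))‖ by the same half-strip identity.
  have h1 := norm_vec_half hψ ((hc.mul hd).shift (-h))
  have h2 := norm_vec_half hψ (hc.shift (-h))
  simp only [← hh, add_neg_cancel, zero_add] at h1 h2
  rw [h1, h2, star_mul, ← G.π_vec _ (hc.mem_Nsym _).2, ← norm_star (d (-h))]
  exact ((G.π _).le_opNorm _).trans (mul_le_mul_of_nonneg_right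
    (NonUnitalStarAlgHom.norm_apply_le G.π _) (norm_nonneg _))

end IsSymEntire

end Weight.GNS

/-! ### Smoothing along a KMS flow -/

namespace Weight

open Filter

variable {A : Type*} [NonUnitalCStarAlgebra A]

/-- The Gaussian means of the orbit of `y`, at scale `r`. -/
def orbitSmoothing (α : OneParamGroup A) (r : ℝ) (y : A) (z : ℂ) : A :=
  smoothing (fun s => α (r * s) y) (z / r)

theorem continuous_orbit (α : OneParamGroup A) (r : ℝ) (y : A) :
    Continuous fun s => α (r * s) y :=
  (α.continuous y).comp (by fun_prop)

theorem norm_orbit_le (α : OneParamGroup A) (r : ℝ) (y : A) (s : ℝ) :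
    ‖α (r * s) y‖ ≤ ‖y‖ := (StarAlgEquiv.norm_map (α (r * s)) y).le

theorem dagger_orbitSmoothing (α : OneParamGroup A) (r : ℝ) (y : A) :
    dagger (orbitSmoothing α r y) = orbitSmoothing α r (star y) := by
  funext z
  simp [dagger, orbitSmoothing, star_smoothing, map_star]

theorem isEntireOrbit_orbitSmoothing (α : OneParamGroup A) {r : ℝ} (hr : r ≠ 0) (y : A) :
    IsEntireOrbit α (orbitSmoothing α r y) where
  differentiable := (differentiable_smoothing (continuous_orbit α r y)
    (norm_orbit_le α r y)).comp (f := fun z : ℂ => z / r) (by fun_prop)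
  add_ofReal z t := by
    let L : A →L[ℂ] A :=
      { toFun := α t, map_add' := _root_.map_add (α t), map_smul' := _root_.map_smul (α t),
        cont := (StarAlgEquiv.isometry (α t)).continuous }
    have h := smoothing_comp L (continuous_orbit α r y) (norm_orbit_le α r y) (z / r)
    change _ = L (smoothing (fun s => α (r * s) y) (z / r))
    rw [← h, orbitSmoothing, add_div, ← Complex.ofReal_div, smoothing_add_ofReal]
    congr 1
    funext s
    change _ = α t (α (r * s) y)
    rw [← α.add_apply]
    congr 2
    field_simp
    ring

variable [PartialOrder A] [StarOrderedRing A]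
  {ψ : Weight A} {α : OneParamGroup A} {β : ℝ}
  {H : Type*} [NormedAddCommGroup H] [InnerProductSpace ℂ H] [CompleteSpace H]

/-- The integral is taken in the graph of Λ, which is complete because Λ is closed; its two
coordinates are the two smoothed orbits. -/
theorem IsKMS.vec_orbitSmoothing (hψ : ψ.IsKMS α β) (G : ψ.GNS H) (r : ℝ) {y : A}
    (hy : y ∈ ψ.Nsym) (z : ℂ) : orbitSmoothing α r y z ∈ ψ.N ∧
      G.vec (orbitSmoothing α r y z) = smoothing (fun s => G.vec (α (r * s) y)) (z / r) := by
  have : CompleteSpace G.graph := (G.isClosed_graph hψ.isProper).completeSpace_coe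
  let w : ℝ → G.graph := fun s =>
    ⟨(α (r * s) y, G.vec (α (r * s) y)), (hψ.invariant _).mem_N.2 hy.1, rfl⟩
  have hw : Continuous w := ((continuous_orbit α r y).prodMk
    ((hψ.continuous_vec G hy).comp (by fun_prop : Continuous fun s : ℝ => r * s))).subtype_mk _
  have hB : ∀ s, ‖w s‖ ≤ max ‖y‖ ‖G.vec y‖ := by
    intro s
    refine max_le_max (norm_orbit_le α r y s) ?_
    exact (G.norm_vec_map (hψ.invariant _) hy.1).le
  have h1 := smoothing_comp (ContinuousLinearMap.fst ℂ A H ∘L G.graph.subtypeL) hw hB (z / r)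
  have h2 := smoothing_comp (ContinuousLinearMap.snd ℂ A H ∘L G.graph.subtypeL) hw hB (z / r)
  have h3 := (smoothing w (z / r)).2
  have e1 : orbitSmoothing α r y z = ((smoothing w (z / r) : G.graph) : A × H).1 := h1
  have e2 : smoothing (fun s => G.vec (α (r * s) y)) (z / r)
      = ((smoothing w (z / r) : G.graph) : A × H).2 := h2
  rw [e1, e2]
  exact h3

theorem IsKMS.isEntire_orbitSmoothing (hψ : ψ.IsKMS α β) (G : ψ.GNS H) {r : ℝ} (hr : r ≠ 0) {y : A}
    (hy : y ∈ ψ.Nsym) : G.IsEntire α (orbitSmoothing α r y) where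
  toIsEntireOrbit := isEntireOrbit_orbitSmoothing α hr y
  mem z := (hψ.vec_orbitSmoothing G r hy z).1
  differentiable_vec := by
    simp only [fun z => (hψ.vec_orbitSmoothing G r hy z).2]
    exact (differentiable_smoothing
      ((hψ.continuous_vec G hy).comp (by fun_prop : Continuous fun s : ℝ => r * s))
      (fun s => (G.norm_vec_map (hψ.invariant (r * s)) hy.1).le)).comp
      (f := fun z : ℂ => z / r) (by fun_prop)

theorem IsKMS.isSymEntire_orbitSmoothing (hψ : ψ.IsKMS α β) (G : ψ.GNS H) {r : ℝ} (hr : r ≠ 0)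
    {y : A} (hy : y ∈ ψ.Nsym) : G.IsSymEntire α (orbitSmoothing α r y) where
  isEntire := hψ.isEntire_orbitSmoothing G hr hy
  isEntire_dagger := by
    rw [dagger_orbitSmoothing]
    exact hψ.isEntire_orbitSmoothing G hr (star_mem_Nsym hy)

/-- The analytic elements `c(0)`. -/
def GNS.entireElements (G : ψ.GNS H) (α : OneParamGroup A) : Submodule ℂ A where
  carrier := {a | ∃ c, G.IsSymEntire α c ∧ c 0 = a}
  zero_mem' := ⟨_, GNS.IsSymEntire.const (fun t => map_zero (α t)) ψ.Nsym.zero_mem, rfl⟩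
  add_mem' := by
    rintro _ _ ⟨c, hc, rfl⟩ ⟨d, hd, rfl⟩
    exact ⟨_, hc.add hd, rfl⟩
  smul_mem' := by
    rintro r _ ⟨c, hc, rfl⟩
    exact ⟨_, hc.smul r, rfl⟩

theorem GNS.mul_mem_entireElements {G : ψ.GNS H} {a b : A} (ha : a ∈ G.entireElements α)
    (hb : b ∈ G.entireElements α) : a * b ∈ G.entireElements α := by
  obtain ⟨c, hc, rfl⟩ := ha
  obtain ⟨d, hd, rfl⟩ := hb
  exact ⟨_, hc.mul hd.isEntire, rfl⟩

theorem GNS.entireElements_le (G : ψ.GNS H) (α : OneParamGroup A) :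
    G.entireElements α ≤ ψ.Nsym := by
  rintro _ ⟨c, hc, rfl⟩
  exact hc.mem_Nsym 0

theorem IsKMS.mem_closure_entireElements (hψ : ψ.IsKMS α β) (G : ψ.GNS H) (a : A) :
    a ∈ closure (G.entireElements α : Set A) := by
  have h : (ψ.Nsym : Set A) ⊆ closure (G.entireElements α : Set A) := by
    intro y hy
    have hlim := tendsto_smoothing (α.continuous y) (fun s => (StarAlgEquiv.norm_map (α s) y).le)
    rw [α.zero_apply] at hlim
    refine mem_closure_of_tendsto hlim ?_
    filter_upwards [self_mem_nhdsWithin] with r hr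
    exact ⟨_, hψ.isSymEntire_orbitSmoothing G (ne_of_gt hr) hy, by simp [orbitSmoothing]⟩
  exact closure_minimal h isClosed_closure (hψ.isProper.mem_closure_Nsym a)

/-- Norm density in A would not suffice, since Λ is unbounded. As the scale tends to 0, the smoothed
vectors themselves converge to Λ(y). -/
theorem IsKMS.dense_vec_entireElements (hψ : ψ.IsKMS α β) (G : ψ.GNS H) :
    Dense (G.vec '' (G.entireElements α : Set A)) := by
  have h : G.vec '' (ψ.Nsym : Set A) ⊆ closure (G.vec '' (G.entireElements α : Set A)) := by
    rintro _ ⟨y, hy, rfl⟩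
    have hlim := tendsto_smoothing (hψ.continuous_vec G hy)
      (fun s => (G.norm_vec_map (hψ.invariant s) hy.1).le)
    rw [α.zero_apply] at hlim
    refine mem_closure_of_tendsto hlim ?_
    filter_upwards [self_mem_nhdsWithin] with r hr
    refine ⟨_, ⟨_, hψ.isSymEntire_orbitSmoothing G (ne_of_gt hr) hy, rfl⟩, ?_⟩
    rw [(hψ.vec_orbitSmoothing G r hy 0).2, zero_div]
  exact dense_closure.1 ((G.dense_vec_Nsym hψ.isProper).mono h)

/-- Right multiplication by an analytic element, as an operator in the commutant. -/
theorem IsKMS.exists_rightMul (hψ : ψ.IsKMS α β) (G : ψ.GNS H) {b : A}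
    (hb : b ∈ G.entireElements α) :
    ∃ R ∈ StarSubalgebra.centralizer ℂ (Set.range G.π),
      ∀ a ∈ G.entireElements α, R (G.vec a) = G.vec (a * b) := by
  obtain ⟨d, hd, rfl⟩ := hb
  let e : G.entireElements α →ₗ[ℂ] H :=
    { toFun := fun a => G.vec a
      map_add' := fun a a' =>
        G.vec_add (G.entireElements_le α a.2).1 (G.entireElements_le α a'.2).1
      map_smul' := fun r a => G.vec_smul r (G.entireElements_le α a.2).1 }
  let f : G.entireElements α →ₗ[ℂ] H :=
    { toFun := fun a => G.vec (a * d 0)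
      map_add' := fun a a' => by
        rw [Submodule.coe_add, add_mul]
        exact G.vec_add (ψ.mul_mem_N _ (hd.mem_Nsym 0).1) (ψ.mul_mem_N _ (hd.mem_Nsym 0).1)
      map_smul' := fun r a => by
        rw [Submodule.coe_smul, smul_mul_assoc]
        exact G.vec_smul r (ψ.mul_mem_N _ (hd.mem_Nsym 0).1) }
  have he : DenseRange e := by
    have h := hψ.dense_vec_entireElements G
    rwa [Set.image_eq_range] at h
  have hbd : ∃ C, ∀ a, ‖f a‖ ≤ C * ‖e a‖ := by
    refine ⟨‖d (-(β / 2 * Complex.I))‖, ?_⟩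
    rintro ⟨_, c, hc, rfl⟩
    exact hc.norm_vec_mul_le hψ hd.isEntire
  have hR : ∀ a (ha : a ∈ G.entireElements α), f.extendOfNorm e (G.vec a) = G.vec (a * d 0) :=
    fun a ha => LinearMap.extendOfNorm_eq he hbd ⟨a, ha⟩
  refine ⟨f.extendOfNorm e, mem_commutant.2 fun a => ?_, hR⟩
  have hπ : Continuous G.π := map_continuous G.π
  -- Left and right multiplications commute on analytic elements; density of these in A and of their
  -- vectors in H extends this to all of π(A).
  refine (closure_minimal (s := (G.entireElements α : Set A))
    (t := {a | G.π a * f.extendOfNorm e = f.extendOfNorm e * G.π a}) ?_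
    (isClosed_eq (by fun_prop) (by fun_prop))) (hψ.mem_closure_entireElements G a)
  intro a ha
  apply ContinuousLinearMap.ext
  intro η
  refine he.induction_on η (isClosed_eq (ContinuousLinearMap.continuous _)
    (ContinuousLinearMap.continuous _)) fun x => ?_
  change G.π a (f.extendOfNorm e (G.vec x)) = f.extendOfNorm e (G.π a (G.vec x))
  rw [hR _ x.2, G.π_vec _ (ψ.mul_mem_N _ (hd.mem_Nsym 0).1),
    G.π_vec _ (G.entireElements_le α x.2).1,
    hR _ (GNS.mul_mem_entireElements ha x.2), mul_assoc]

/-- A projection that is fixed by the flow has finite weight. -/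
theorem IsKMS.proj_mem_Nsym (hψ : ψ.IsKMS α β) (G : ψ.GNS H) {p : A} (hp : IsStarProjection p)
    (hαp : ∀ t, α t p = p) : p ∈ ψ.Nsym := by
  suffices h : p ∈ ψ.N from ⟨h, by rwa [hp.isSelfAdjoint.star_eq]⟩
  have hpp : p * p = p := hp.isIdempotentElem.eq
  have hps : star p = p := hp.isSelfAdjoint.star_eq
  obtain ⟨y, hy, hlim⟩ := mem_closure_iff_seq_limit.1 (hψ.isProper.mem_closure_Nsym p)
  -- Scale 1 suffices: p is invariant and so equal to its own Gaussian mean, and the smoothed y_n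
  -- still tend to p.
  have hx : ∀ n, G.IsSymEntire α (orbitSmoothing α 1 (y n)) := fun n =>
    hψ.isSymEntire_orbitSmoothing G one_ne_zero (hy n)
  have hxlim : Tendsto (fun n => orbitSmoothing α 1 (y n) 0) atTop (𝓝 p) := by
    rw [tendsto_iff_norm_sub_tendsto_zero] at hlim ⊢
    refine squeeze_zero (fun n => norm_nonneg _) (fun n => ?_) hlim
    have h1 : orbitSmoothing α 1 (y n) 0 - p = smoothing (fun s => α (1 * s) (y n - p)) 0 := by
      nth_rewrite 1 [← smoothing_const p]
      rw [orbitSmoothing, zero_div, smoothing_sub (continuous_orbit α 1 (y n))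
        (norm_orbit_le α 1 (y n)) continuous_const (fun _ => le_rfl)]
      simp only [_root_.map_sub, hαp]
    rw [h1]
    simpa using norm_smoothing_le (norm_orbit_le α 1 (y n - p)) 0
  -- Write x_n for the smoothed y_n. Then x_n p x_m tends to x_n p as m grows, and Λ(x_n p x_m) is
  -- bounded by ‖p x_m(-iβ/2)‖ ‖Λ(x_n)‖ with ‖x_m(-iβ/2)‖ ≤ exp(β²/4)‖y_m‖, uniformly for large m.
  -- Lower semi-continuity gives x_n p in 𝒩_ψ.
  have hxp : ∀ n, orbitSmoothing α 1 (y n) 0 * p ∈ ψ.N := by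
    intro n
    have hl : Tendsto (fun m => orbitSmoothing α 1 (y n) 0 * (p * orbitSmoothing α 1 (y m) 0)) atTop
        (𝓝 (orbitSmoothing α 1 (y n) 0 * p)) := by
      have := (hxlim.const_mul p).const_mul (orbitSmoothing α 1 (y n) 0)
      rwa [hpp] at this
    have hbd : ∀ᶠ m in atTop, ‖y m‖ < ‖p‖ + 1 :=
      hlim.norm.eventually_lt_const (lt_add_one _)
    refine (G.mem_N_of_tendsto hψ.isProper hl
      (C := ‖p‖ * (Real.exp ((-(β / 2 * Complex.I) / (1 : ℝ) : ℂ).im ^ 2) * (‖p‖ + 1))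
        * ‖G.vec (orbitSmoothing α 1 (y n) 0)‖) ?_).1
    filter_upwards [hbd] with m hm
    have hq := (hx m).isEntire.mul_left (IsEntireOrbit.const hαp)
    refine ⟨ψ.mul_mem_N _ (hq.mem 0), ((hx n).norm_vec_mul_le hψ hq).trans ?_⟩
    refine mul_le_mul_of_nonneg_right ((norm_mul_le _ _).trans ?_) (norm_nonneg _)
    refine mul_le_mul_of_nonneg_left ?_ (norm_nonneg _)
    exact (norm_smoothing_le (norm_orbit_le α 1 (y m)) _).trans (by gcongr)
  -- The elements p x_n p tend to p inside pAp, so eventually w ≤ p/2, that is p ≤ 2(p x_n p)⋆(p x_n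
  -- p), which has finite weight.
  have hw : Tendsto (fun n => p - star (p * (orbitSmoothing α 1 (y n) 0 * p))
      * (p * (orbitSmoothing α 1 (y n) 0 * p))) atTop (𝓝 0) := by
    have h1 := (hxlim.mul_const p).const_mul p
    have h2 := (h1.star.mul h1).const_sub p
    simpa [hpp, hps] using h2
  obtain ⟨n, hn⟩ := (hw.norm.eventually_lt_const (by rw [norm_zero]; exact one_half_pos)).exists
  set x := orbitSmoothing α 1 (y n) 0
  set w := p - star (p * (x * p)) * (p * (x * p)) with hwdef
  have hpos : 0 ≤ p := by rw [← hpp]; nth_rewrite 1 [← hps]; exact star_mul_self_nonneg p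
  have hwsa : IsSelfAdjoint w := hp.isSelfAdjoint.sub (IsSelfAdjoint.star_mul_self _)
  have hpw : star p * w * p = w := by
    rw [hwdef, hps]
    simp only [star_mul, hps, mul_sub, sub_mul, mul_assoc, hpp]
    simp only [← mul_assoc, hpp]
  have hle : w ≤ (1 / 2 : ℝ) • p := by
    have h1 := CStarAlgebra.star_left_conjugate_le_norm_smul (a := p) hwsa
    rw [hpw, hps, hpp] at h1
    exact h1.trans (smul_le_smul_of_nonneg_right hn.le hpos)
  have hfin : p ∈ ψ.finitePos := by
    refine ψ.finitePos_of_le hpos ?_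
      (ψ.finitePos_smul zero_le_two (mem_N'.1 (ψ.mul_mem_N p (hxp n))))
    have h1 : p - (1 / 2 : ℝ) • p ≤ star (p * (x * p)) * (p * (x * p)) := by
      rw [hwdef, sub_le_iff_le_add] at hle
      rwa [sub_le_iff_le_add, add_comm]
    have h2 := smul_le_smul_of_nonneg_left h1 (zero_le_two (α := ℝ))
    have h3 : (2 : ℝ) • (p - (1 / 2 : ℝ) • p) = p := by
      rw [smul_sub, smul_smul, two_smul]; norm_num
    rwa [h3] at h2
  exact ψ.mem_N_of_finitePos hfin

end Weight

/-! ### The corner of a KMS weight -/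

section CornerOfWeight

open ContinuousLinearMap

variable {A : Type*} [NonUnitalCStarAlgebra A] {p : A} {hp : IsStarProjection p}

theorem corner_mul_self_left (x : corner p hp) : p * (x : A) = x := by
  obtain ⟨_, a, rfl⟩ := x
  change p * (p * a * p) = p * a * p
  rw [← mul_assoc, ← mul_assoc, hp.isIdempotentElem.eq]

variable [PartialOrder A] [StarOrderedRing A] {ψ : Weight A}
  {Hψ : Type*} [NormedAddCommGroup Hψ] [InnerProductSpace ℂ Hψ] [CompleteSpace Hψ]
  {Hφ : Type*} [NormedAddCommGroup Hφ] [InnerProductSpace ℂ Hφ] [CompleteSpace Hφ]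

theorem corner_mem_N (hpN : p ∈ ψ.N) (x : corner p hp) : (x : A) ∈ ψ.N := by
  obtain ⟨_, a, rfl⟩ := x
  exact ψ.mul_mem_N _ hpN

theorem StateGNS.norm_orbit_sq {B : Type*} [NonUnitalRing B] [StarRing B] [Module ℂ B] {φ : B → ℂ}
    (G : StateGNS φ Hφ) (b : B) : ((‖G.orbit b‖ : ℂ)) ^ 2 = φ (star b * b) := by
  have h := inner_self_eq_norm_sq_to_K (𝕜 := ℂ) (G.orbit b)
  rw [← G.inner_ξ, map_mul, map_star, star_eq_adjoint, mul_apply_eq_comp, adjoint_inner_right]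
  exact h.symm

/-- The constant `ψ(p)^(-1/2)`. -/
def cornerScale (G : ψ.GNS Hψ) (p : A) : ℝ := ‖G.vec p‖⁻¹

/-- Both squared norms are ψ(p)⁻¹ψ(x⋆x), since ψ(p) = ‖Λ(p)‖². With 0⁻¹ = 0 this needs no
non-vanishing of ψ(p). -/
theorem norm_smul_vec_corner (hpN : p ∈ ψ.N) (Gψ : ψ.GNS Hψ)
    (Gφ : StateGNS (ψ.cornerState p hp) Hφ) (x : corner p hp) :
    ‖((cornerScale Gψ p : ℝ) : ℂ) • Gψ.vec x‖ = ‖Gφ.orbit x‖ := by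
  have hvec : ∀ {a : A}, a ∈ ψ.N → ψ.ext (star a * a) = (‖Gψ.vec a‖ : ℂ) ^ 2 := by
    intro a ha
    rw [← Gψ.inner_vec ha ha]
    exact inner_self_eq_norm_sq_to_K (𝕜 := ℂ) (Gψ.vec a)
  have hpe : ψ.ext p = (‖Gψ.vec p‖ : ℂ) ^ 2 := by
    rw [← hvec hpN, hp.isSelfAdjoint.star_eq, hp.isIdempotentElem.eq]
  have h := Gφ.norm_orbit_sq x
  have e : ψ.cornerState p hp (star x * x) = (ψ.ext p)⁻¹ * ψ.ext (star (x : A) * x) := rfl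
  rw [e, hvec (corner_mem_N hpN x), hpe] at h
  rw [← sq_eq_sq₀ (norm_nonneg _) (norm_nonneg _)]
  apply Complex.ofReal_injective
  push_cast
  rw [h, norm_smul, Complex.norm_real, cornerScale, norm_inv, norm_norm]
  push_cast
  rw [mul_pow, inv_pow]

/-- The isometry `V` with `V π_φ(x)ξ_φ = ψ(p)^(-1/2) Λ_ψ(x)`. -/
theorem exists_cornerIntertwiner (hpN : p ∈ ψ.N) (Gψ : ψ.GNS Hψ)
    (Gφ : StateGNS (ψ.cornerState p hp) Hφ) :
    ∃ V : Hφ →L[ℂ] Hψ, IsCornerIntertwiner p hp Gψ.π Gφ.π V ∧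
      ∀ x, V (Gφ.orbit x) = ((cornerScale Gψ p : ℝ) : ℂ) • Gψ.vec x := by
  let f : corner p hp →ₗ[ℂ] Hψ :=
    { toFun := fun x => ((cornerScale Gψ p : ℝ) : ℂ) • Gψ.vec x
      map_add' := fun x y => by
        rw [← smul_add, ← Gψ.vec_add (corner_mem_N hpN x) (corner_mem_N hpN y)]; rfl
      map_smul' := fun r x => by
        rw [RingHom.id_apply, smul_comm, ← Gψ.vec_smul r (corner_mem_N hpN x)]; rfl }
  have hf : ∀ x, ‖f x‖ = ‖Gφ.orbit x‖ := norm_smul_vec_corner hpN Gψ Gφ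
  have hdense : DenseRange Gφ.orbit := Gφ.cyclic
  have hV : ∀ x, f.extendOfNorm Gφ.orbit (Gφ.orbit x) = f x :=
    LinearMap.extendOfNorm_eq hdense ⟨1, fun x => by rw [hf, one_mul]⟩
  refine ⟨f.extendOfNorm Gφ.orbit, ⟨?_, fun k => ?_, fun a k => ?_⟩, hV⟩
  · refine (norm_map_iff_adjoint_comp_self _).1 fun k => ?_
    refine hdense.induction_on k (isClosed_eq (f.extendOfNorm Gφ.orbit).continuous.norm
      continuous_norm) fun x => ?_
    rw [hV, hf]
  · refine hdense.induction_on k (isClosed_eq (Gψ.π p ∘L f.extendOfNorm Gφ.orbit).continuous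
      (f.extendOfNorm Gφ.orbit).continuous) fun x => ?_
    rw [hV]
    change Gψ.π p (((cornerScale Gψ p : ℝ) : ℂ) • Gψ.vec x)
      = ((cornerScale Gψ p : ℝ) : ℂ) • Gψ.vec x
    rw [map_smul, Gψ.π_vec _ (corner_mem_N hpN x), corner_mul_self_left]
  · refine hdense.induction_on k (isClosed_eq
      ((Gψ.π p * Gψ.π a) ∘L f.extendOfNorm Gφ.orbit).continuous
      (f.extendOfNorm Gφ.orbit ∘L Gφ.π ⟨p * a * p, a, rfl⟩).continuous) fun x => ?_
    have e : Gφ.π ⟨p * a * p, a, rfl⟩ (Gφ.orbit x) = Gφ.orbit (⟨p * a * p, a, rfl⟩ * x) := by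
      simp [StateGNS.orbit]
    rw [e, hV, hV]
    change Gψ.π p (Gψ.π a (((cornerScale Gψ p : ℝ) : ℂ) • Gψ.vec x))
      = ((cornerScale Gψ p : ℝ) : ℂ) • Gψ.vec (p * a * p * x)
    rw [map_smul, map_smul, Gψ.π_vec _ (corner_mem_N hpN x),
      Gψ.π_vec _ (ψ.mul_mem_N _ (corner_mem_N hpN x)), mul_assoc, corner_mul_self_left, mul_assoc]

/-- The projection p is itself analytic, with constant orbit, so right multiplication by b applies
to it: π(p)Λ(b) = Λ(pb) = R_bΛ(p). -/
theorem exists_commutant_apply_vec_proj {α : OneParamGroup A} {β : ℝ} (hψ : ψ.IsKMS α β)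
    (hαp : ∀ t, α t p = p) (hpN : p ∈ ψ.Nsym) (G : ψ.GNS Hψ) {b : A}
    (hb : b ∈ G.entireElements α) :
    ∃ R ∈ StarSubalgebra.centralizer ℂ (Set.range G.π), G.π p (G.vec b) = R (G.vec p) := by
  obtain ⟨R, hR, hRv⟩ := hψ.exists_rightMul G hb
  refine ⟨R, hR, ?_⟩
  rw [G.π_vec _ (G.entireElements_le α hb).1,
    hRv p ⟨_, Weight.GNS.IsSymEntire.const hαp hpN, rfl⟩]

/-- A full projection that is fixed by the flow has non-zero weight. -/
theorem vec_proj_ne_zero {α : OneParamGroup A} {β : ℝ} (hψ : ψ.IsKMS α β)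
    (hαp : ∀ t, α t p = p) (hpN : p ∈ ψ.Nsym) (hfull : IsFull p) (G : ψ.GNS Hψ) :
    G.vec p ≠ 0 := by
  intro h0
  -- If Λ(p) = 0 then π(p)Λ(b) = R_bΛ(p) = 0 on a dense set. Fullness then gives π = 0,
  -- non-degeneracy H = 0, and lower semi-continuity ψ = 0.
  have hπp : G.π p = 0 := by
    ext η
    have hcl : IsClosed {η | G.π p η = 0} := isClosed_eq (G.π p).continuous continuous_const
    refine closure_minimal ?_ hcl (hψ.dense_vec_entireElements G η)
    rintro _ ⟨b, hb, rfl⟩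
    obtain ⟨R, -, hRv⟩ := exists_commutant_apply_vec_proj hψ hαp hpN G hb
    rw [h0, map_zero] at hRv
    exact hRv
  have hπ : ∀ a, G.π a = 0 := by
    intro a
    have hcl : IsClosed {a | G.π a = 0} := isClosed_eq (map_continuous G.π) continuous_const
    refine closure_minimal ?_ hcl (hfull a)
    intro x hx
    induction hx using Submodule.span_induction with
    | mem x hx => obtain ⟨b, c, rfl⟩ := hx; simp [hπp]
    | zero => simp
    | add x y _ _ hx hy =>
      change G.π (x + y) = 0
      rw [map_add, hx, hy, add_zero]
    | smul r x _ hx =>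
      change G.π (r • x) = 0
      rw [map_smul, hx, smul_zero]
  have hH : ∀ η : Hψ, η = 0 := by
    intro η
    refine closure_minimal (t := {0}) ?_ isClosed_singleton (G.nondegenerate η)
    rw [← Submodule.bot_coe (R := ℂ), SetLike.coe_subset_coe, Submodule.span_le]
    rintro _ ⟨a, ζ, rfl⟩
    simp [hπ]
  obtain ⟨a, ha⟩ := hψ.isProper.ne_zero
  refine ha (le_antisymm ?_ bot_le)
  have hcl := hψ.isProper.closed 0 le_rfl
  rw [ENNReal.ofReal_zero] at hcl
  refine closure_minimal ?_ hcl (hψ.isProper.dense a)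
  rintro ⟨b, hb⟩ hfin
  obtain ⟨s, rfl⟩ := CStarAlgebra.nonneg_iff_eq_star_mul_self.1 hb
  have hs : s ∈ ψ.N := hfin
  have hn := G.norm_vec_sq hs
  rw [hH (G.vec s), norm_zero, zero_pow two_ne_zero] at hn
  exact (((ENNReal.toReal_eq_zero_iff _).1 hn.symm).resolve_right (ne_of_lt hfin)).le

/-- `Λ_ψ(p)` is cyclic for the commutant on the range of `π_ψ(p)`. -/
theorem proj_mem_generatedSubspace {α : OneParamGroup A} {β : ℝ} (hψ : ψ.IsKMS α β)
    (hαp : ∀ t, α t p = p) (hpN : p ∈ ψ.Nsym) (hfull : IsFull p) (Gψ : ψ.GNS Hψ)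
    (Gφ : StateGNS (ψ.cornerState p hp) Hφ) {V : Hφ →L[ℂ] Hψ}
    (hV : ∀ x, V (Gφ.orbit x) = ((cornerScale Gψ p : ℝ) : ℂ) • Gψ.vec x) (η : Hψ) :
    Gψ.π p η ∈ generatedSubspace
      (StarSubalgebra.centralizer ℂ (Set.range Gψ.π) : Set (Hψ →L[ℂ] Hψ)) V := by
  obtain ⟨k, hk⟩ : ∃ k, V k = Gψ.vec p := by
    -- The witness is ‖Λ(p)‖ π_φ(p)ξ_φ; undoing the scale in V is where Λ(p) ≠ 0 is needed.
    refine ⟨((cornerScale Gψ p : ℝ) : ℂ)⁻¹ • Gφ.orbit ⟨p, p, by simp [hp.isIdempotentElem.eq]⟩, ?_⟩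
    rw [map_smul, hV, smul_smul, inv_mul_cancel₀, one_smul]
    simpa [cornerScale] using vec_proj_ne_zero hψ hαp hpN hfull Gψ
  have hcl : IsClosed (generatedSubspace
      (StarSubalgebra.centralizer ℂ (Set.range Gψ.π) : Set (Hψ →L[ℂ] Hψ)) V : Set Hψ) :=
    Submodule.isClosed_topologicalClosure _
  have h := map_mem_closure (Gψ.π p).continuous (hψ.dense_vec_entireElements Gψ η)
    (t := generatedSubspace
      (StarSubalgebra.centralizer ℂ (Set.range Gψ.π) : Set (Hψ →L[ℂ] Hψ)) V) (by
      rintro _ ⟨b, hb, rfl⟩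
      obtain ⟨R, hR, hRv⟩ := exists_commutant_apply_vec_proj hψ hαp hpN Gψ hb
      rw [hRv, ← hk]
      exact apply_mem_generatedSubspace V hR k)
  rwa [hcl.closure_eq] at h

theorem coe_modularGroup_weight {α : OneParamGroup A} {β : ℝ} (hψ : ψ.IsKMS α β) (G : ψ.GNS Hψ)
    (t : ℝ) (x : bicommutant G.π) : (G.modularGroup hψ t x : Hψ →L[ℂ] Hψ)
      = (G.unitary (hψ.invariant (-β * t))).conjStarAlgEquiv (x : Hψ →L[ℂ] Hψ) := rfl

theorem coe_modularGroup_state {B : Type*} [NonUnitalRing B] [StarRing B] [Module ℂ B]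
    [TopologicalSpace B] {φ : B → ℂ} (G : StateGNS φ Hφ) (α : OneParamGroup B)
    (hφ : ∀ t b, φ (α t b) = φ b) (β t : ℝ) (x : bicommutant G.π) :
    (G.modularGroup α hφ β t x : Hφ →L[ℂ] Hφ)
      = (G.unitary (hφ (-β * t))).conjStarAlgEquiv (x : Hφ →L[ℂ] Hφ) := rfl

theorem modularGroup_proj {α : OneParamGroup A} {β : ℝ} (hψ : ψ.IsKMS α β)
    (hαp : ∀ t, α t p = p) (G : ψ.GNS Hψ) (t : ℝ) :
    G.modularGroup hψ t ⟨G.π p, mem_bicommutant G.π p⟩ = ⟨G.π p, mem_bicommutant G.π p⟩ := by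
  apply Subtype.ext
  rw [coe_modularGroup_weight, G.unitary_conj, hαp]

/-- By `conj_compress` it is enough that V intertwines the implementing unitaries; both composites
send π_φ(z)ξ_φ to the same multiple of Λ(α_s(z)). -/
theorem compression_modularGroup {α : OneParamGroup A} {β : ℝ} (hψ : ψ.IsKMS α β)
    (hαp : ∀ t, α t p = p) (hpN : p ∈ ψ.N) (Gψ : ψ.GNS Hψ)
    (Gφ : StateGNS (ψ.cornerState p hp) Hφ) {V : Hφ →L[ℂ] Hψ}
    (hV : IsCornerIntertwiner p hp Gψ.π Gφ.π V)
    (hVx : ∀ x, V (Gφ.orbit x) = ((cornerScale Gψ p : ℝ) : ℂ) • Gψ.vec x) (t : ℝ)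
    (x y : corner (⟨Gψ.π p, mem_bicommutant Gψ.π p⟩ : bicommutant Gψ.π)
      (isStarProjection_bicommutant Gψ.π hp))
    (hy : (y : bicommutant Gψ.π) = Gψ.modularGroup hψ t x) :
    Gφ.modularGroup (α.restrictCorner p hp hαp) (hψ.cornerState_invariant hαp) β t
      (hV.compression x) = hV.compression y := by
  have hdense : DenseRange Gφ.orbit := Gφ.cyclic
  apply Subtype.ext
  rw [coe_modularGroup_state, hV.coe_compression, hV.coe_compression, hy, coe_modularGroup_weight]
  refine conj_compress (fun k => ?_) _
  refine hdense.induction_on k (isClosed_eq (V.continuous.comp (LinearIsometryEquiv.continuous _))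
    ((LinearIsometryEquiv.continuous _).comp V.continuous)) fun z => ?_
  rw [StateGNS.unitary_orbit, hVx, hVx, map_smul, Gψ.unitary_vec _ (corner_mem_N hpN z)]
  rfl

-- The modular group of ψ fixes π(p) and hence preserves the corner, so the equivariance of the
-- compression passes to its inverse.
set_option maxHeartbeats 1000000 in
theorem cornerEquiv_modularGroup {α : OneParamGroup A} {β : ℝ} (hψ : ψ.IsKMS α β)
    (hαp : ∀ t, α t p = p) (hpN : p ∈ ψ.N) (Gψ : ψ.GNS Hψ)
    (Gφ : StateGNS (ψ.cornerState p hp) Hφ) {V : Hφ →L[ℂ] Hψ}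
    (hV : IsCornerIntertwiner p hp Gψ.π Gφ.π V)
    (hVx : ∀ x, V (Gφ.orbit x) = ((cornerScale Gψ p : ℝ) : ℂ) • Gψ.vec x)
    (hbij : Function.Bijective hV.compression) (t : ℝ) (m : bicommutant Gφ.π) :
    (hV.cornerEquiv hbij (Gφ.modularGroup (α.restrictCorner p hp hαp)
        (hψ.cornerState_invariant hαp) β t m) : bicommutant Gψ.π)
      = Gψ.modularGroup hψ t (hV.cornerEquiv hbij m : bicommutant Gψ.π) := by
  have hmem : ∀ x : corner (⟨Gψ.π p, mem_bicommutant Gψ.π p⟩ : bicommutant Gψ.π)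
      (isStarProjection_bicommutant Gψ.π hp), Gψ.modularGroup hψ t x ∈
        corner (⟨Gψ.π p, mem_bicommutant Gψ.π p⟩ : bicommutant Gψ.π)
          (isStarProjection_bicommutant Gψ.π hp) := fun x =>
    map_mem_corner (Gψ.modularGroup hψ t) (modularGroup_proj hψ hαp Gψ t) x.2
  refine (hbij.2 m).elim fun x hx => ?_
  have h1 := congrArg (hV.cornerEquiv hbij)
    (compression_modularGroup hψ hαp hpN Gψ Gφ hV hVx t x ⟨_, hmem x⟩ rfl)
  have h2 := hV.cornerEquiv_compression x hbij
  rw [hx] at h1 h2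
  rw [h2]
  exact congrArg Subtype.val (h1.trans (hV.cornerEquiv_compression ⟨_, hmem x⟩ hbij))

end CornerOfWeight

end KMSCorner

end

/-! ### The isomorphism and its equivariance -/

open KMSCorner
theorem lemma2p3 {A : Type*} [NonUnitalCStarAlgebra A] [PartialOrder A] [StarOrderedRing A]
    (α : OneParamGroup A) (p : A) (hp : IsStarProjection p) (hαp : ∀ t, α t p = p)
    (hfull : IsFull p) (β : ℝ) (ψ : Weight A) (hψ : ψ.IsKMS α β)
    {Hψ : Type*} [NormedAddCommGroup Hψ] [InnerProductSpace ℂ Hψ] [CompleteSpace Hψ]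
    (Gψ : ψ.GNS Hψ)
    {Hφ : Type*} [NormedAddCommGroup Hφ] [InnerProductSpace ℂ Hφ] [CompleteSpace Hφ]
    (Gφ : StateGNS (ψ.cornerState p hp) Hφ) :
    ∃ Φ : bicommutant Gφ.π ≃⋆ₐ[ℂ]
        corner (⟨Gψ.π p, mem_bicommutant Gψ.π p⟩ : bicommutant Gψ.π)
          (isStarProjection_bicommutant Gψ.π hp),
      ∀ (t : ℝ) (m : bicommutant Gφ.π),
        (Φ (Gφ.modularGroup (α.restrictCorner p hp hαp) (hψ.cornerState_invariant hαp) β t m) :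
            bicommutant Gψ.π)
          = Gψ.modularGroup hψ t (Φ m : bicommutant Gψ.π) := by
  have hpN := hψ.proj_mem_Nsym Gψ hp hαp
  exact (exists_cornerIntertwiner hpN.1 Gψ Gφ).elim fun V hV =>
    ⟨hV.1.cornerEquiv ⟨hV.1.compression_injective
        (proj_mem_generatedSubspace hψ hαp hpN hfull Gψ Gφ hV.2), hV.1.compression_surjective⟩,
      cornerEquiv_modularGroup hψ hαp hpN.1 Gψ Gφ hV.1 hV.2 _⟩
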